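/- Let $d\ge 2$. There exists a constant $K_d>0$, depending only on $d$, such that the following holds. Let $M$ be either $\mathbb R^d$ or $\mathbb T^d=\mathbb R^d/\mathbb Z^d$ (functions on $\mathbb T^d$ being identified with $\mathbb Z^d$-periodic functions on $\mathbb R^d$), with Lebesgue measure. Let $p\in[2,\infty]$ and let $A\in L^p(M;\mathbb R^{d\times d})$ be antisymmetric almost everywhere. Assume that there is a sequence $(g_n)_{n\in\mathbb N}\subset L^\infty(M)$ of real-valued functions whose weak gradients satisfy $\nabla g_n\in L^2(M;\mathbb R^d)\cap L^{\frac{2p}{p-2}}(M;\mathbb R^d)$ (where $\frac{2p}{p-2}=\infty$ if $p=2$ and $\frac{2p}{p-2}=2$ if $p=\infty$), such that 1. $\nabla g_n\to 0$ weakly in $L^2$, and $\int_M g_n h\to\int_M h$ for all $h\in L^1(M)$; 2. $g_nA\in L^\infty$ for every $n\in\mathbb N$; 3. $A\nabla g_n\to 0$ weakly in $L^2$. Let moreover $b_2:M\to\mathbb R^d$ satisfy either $b_2\in L^r(M;\mathbb R^d)$ for some $r\in(d,\infty]$, or $d\ge 3$, $b_2\in L^d(M;\mathbb R^d)$ and $\|b_2\|_{L^d}\le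 K_d$. Let $\mathcal A$ be either of the operators $\mathcal A f=b_2\cdot\nabla f$ or $\mathcal A f=\nabla\cdot(b_2f)$. Then there exists $\lambda_0>0$ such that for every $\lambda>\lambda_0$ the only real-valued $u\in H^1(M)$ that solves $$\lambda u-\Delta u-\nabla\cdot(A\nabla u)-\mathcal A u=0$$ in the sense of distributions, i.e. tested against all $\varphi\in C_c^\infty(M)$, is $u=0$ (almost everywhere). -/

import Mathlib

open MeasureTheory Filter Topology
open scoped ENNReal ContDiff

/-- The two domains: `ℝ^d`, and the torus `𝕋^d = ℝ^d / ℤ^d`. Functions on the torus are identified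
with `ℤ^d`-periodic functions on `ℝ^d`. -/
inductive FlatDomain where
  | euclidean
  | torus

namespace FlatDomain

/-- The half-open unit cell `[0,1)^d`. -/
def unitCell (d : ℕ) : Set (EuclideanSpace ℝ (Fin d)) :=
  {x | ∀ i, x i ∈ Set.Ico (0 : ℝ) 1}

/-- Lebesgue measure of the domain; on the torus, integration over one unit cell. -/
noncomputable def vol (M : FlatDomain) (d : ℕ) : Measure (EuclideanSpace ℝ (Fin d)) :=
  match M with
  | euclidean => volume
  | torus => volume.restrict (unitCell d)

/-- `f` is (the lift to `ℝ^d` of) a function on the domain: no condition on `ℝ^d`, and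
`ℤ^d`-periodicity on the torus. -/
def IsFunction (M : FlatDomain) {d : ℕ} {F : Type*} (f : EuclideanSpace ℝ (Fin d) → F) : Prop :=
  match M with
  | euclidean => True
  | torus => ∀ (k : Fin d → ℤ) (x : EuclideanSpace ℝ (Fin d)),
      f (x + WithLp.toLp 2 (fun i => (k i : ℝ))) = f x

/-- The test functions `C_c^∞(M)`: smooth functions on the domain with compact support (the latter
is automatic on the compact torus). -/
def IsTest (M : FlatDomain) {d : ℕ} (φ : EuclideanSpace ℝ (Fin d) → ℝ) : Prop :=
  ContDiff ℝ ∞ φ ∧ M.IsFunction φ ∧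
    match M with
    | euclidean => HasCompactSupport φ
    | torus => True

/-- `f ∈ L^p(M; F)`. -/
def InLp (M : FlatDomain) {d : ℕ} {F : Type*} [NormedAddCommGroup F]
    (f : EuclideanSpace ℝ (Fin d) → F) (p : ℝ≥0∞) : Prop :=
  M.IsFunction f ∧ MemLp f p (M.vol d)

/-- `A ∈ L^p(M; ℝ^{d × d})`, expressed through the entries. -/
def MatrixInLp (M : FlatDomain) {d : ℕ}
    (A : EuclideanSpace ℝ (Fin d) → Matrix (Fin d) (Fin d) ℝ) (p : ℝ≥0∞) : Prop :=
  ∀ i j, M.InLp (fun x => A x i j) p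

/-- `G` is the weak (distributional) gradient of `f` on the domain. -/
def HasWeakGradient (M : FlatDomain) {d : ℕ} (f : EuclideanSpace ℝ (Fin d) → ℝ)
    (G : EuclideanSpace ℝ (Fin d) → EuclideanSpace ℝ (Fin d)) : Prop :=
  M.IsFunction f ∧ M.IsFunction G ∧
  LocallyIntegrable f (M.vol d) ∧ LocallyIntegrable G (M.vol d) ∧
  ∀ φ : EuclideanSpace ℝ (Fin d) → ℝ, M.IsTest φ → ∀ i : Fin d,
    ∫ x, f x * gradient φ x i ∂(M.vol d) = - ∫ x, G x i * φ x ∂(M.vol d)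

/-- The matrix-vector product `A ξ` as an element of Euclidean space. -/
noncomputable def matVec {d : ℕ} (A : Matrix (Fin d) (Fin d) ℝ) (ξ : EuclideanSpace ℝ (Fin d)) :
    EuclideanSpace ℝ (Fin d) :=
  WithLp.toLp 2 (A.mulVec ξ.ofLp)

/-- The sequence `(g_n)` of cutoffs adapted to a matrix field `A ∈ L^p`.
The exponent `(2⁻¹ - p⁻¹)⁻¹` is `2p/(p-2)`, read as `∞` for `p = 2` and as `2` for `p = ∞`. -/
def IsCutoffSequence (M : FlatDomain) {d : ℕ} (p : ℝ≥0∞)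
    (A : EuclideanSpace ℝ (Fin d) → Matrix (Fin d) (Fin d) ℝ)
    (g : ℕ → EuclideanSpace ℝ (Fin d) → ℝ) : Prop :=
  (∀ n, M.InLp (g n) ⊤) ∧
  ∃ Dg : ℕ → EuclideanSpace ℝ (Fin d) → EuclideanSpace ℝ (Fin d),
    (∀ n, M.HasWeakGradient (g n) (Dg n)) ∧
    (∀ n, M.InLp (Dg n) 2) ∧
    (∀ n, M.InLp (Dg n) (2⁻¹ - p⁻¹)⁻¹) ∧
    -- `∇ g_n → 0` weakly in `L²`
    (∀ h : EuclideanSpace ℝ (Fin d) → EuclideanSpace ℝ (Fin d), M.InLp h 2 →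
      Tendsto (fun n => ∫ x, inner ℝ (Dg n x) (h x) ∂(M.vol d)) atTop (𝓝 0)) ∧
    -- `∫ g_n h → ∫ h` for all `h ∈ L¹`
    (∀ h : EuclideanSpace ℝ (Fin d) → ℝ, M.InLp h 1 →
      Tendsto (fun n => ∫ x, g n x * h x ∂(M.vol d)) atTop (𝓝 (∫ x, h x ∂(M.vol d)))) ∧
    -- `g_n A ∈ L^∞`
    (∀ n, M.MatrixInLp (fun x => g n x • A x) ⊤) ∧
    -- `A ∇ g_n → 0` weakly in `L²`
    (∀ n, M.InLp (fun x => matVec (A x) (Dg n x)) 2) ∧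
    (∀ h : EuclideanSpace ℝ (Fin d) → EuclideanSpace ℝ (Fin d), M.InLp h 2 →
      Tendsto (fun n => ∫ x, inner ℝ (matVec (A x) (Dg n x)) (h x) ∂(M.vol d)) atTop (𝓝 0))

/-- The two possible first-order operators: `f ↦ b · ∇f` and `f ↦ ∇ · (b f)`. -/
inductive DriftForm where
  | transport
  | divergence

/-- The distributional pairing with `φ` of `b · ∇u`, respectively of `∇ · (b u)`, where `Du` is the
weak gradient of `u`. -/
noncomputable def driftPairing (M : FlatDomain) {d : ℕ} (form : DriftForm)
    (b : EuclideanSpace ℝ (Fin d) → EuclideanSpace ℝ (Fin d))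
    (u : EuclideanSpace ℝ (Fin d) → ℝ)
    (Du : EuclideanSpace ℝ (Fin d) → EuclideanSpace ℝ (Fin d))
    (φ : EuclideanSpace ℝ (Fin d) → ℝ) : ℝ :=
  match form with
  | .transport => ∫ x, inner ℝ (b x) (Du x) * φ x ∂(M.vol d)
  | .divergence => - ∫ x, u x * inner ℝ (b x) (gradient φ x) ∂(M.vol d)

/-- `u ∈ H¹(M)` solves `lam u - Δu - ∇ · (A ∇u) - 𝒜u = 0` in the sense of distributions, where `𝒜`
is `b · ∇` or `∇ · (b ·)` according to `form`. -/
def IsH1Solution (M : FlatDomain) {d : ℕ}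
    (A : EuclideanSpace ℝ (Fin d) → Matrix (Fin d) (Fin d) ℝ)
    (form : DriftForm) (b : EuclideanSpace ℝ (Fin d) → EuclideanSpace ℝ (Fin d))
    (lam : ℝ) (u : EuclideanSpace ℝ (Fin d) → ℝ) : Prop :=
  M.InLp u 2 ∧
  ∃ Du : EuclideanSpace ℝ (Fin d) → EuclideanSpace ℝ (Fin d),
    M.HasWeakGradient u Du ∧ M.InLp Du 2 ∧
    ∀ φ : EuclideanSpace ℝ (Fin d) → ℝ, M.IsTest φ →
      lam * ∫ x, u x * φ x ∂(M.vol d)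
        + ∫ x, inner ℝ (Du x) (gradient φ x) ∂(M.vol d)
        + ∫ x, inner ℝ (matVec (A x) (Du x)) (gradient φ x) ∂(M.vol d)
        - M.driftPairing form b u Du φ = 0

end FlatDomain

/-! The proof is an energy estimate. Formally one tests the equation with `u`: antisymmetry removes
`A ∇u · ∇u`, and the drift is absorbed by the Laplacian and by `λ‖u‖²`. Since `A` may be unbounded,
`A ∇u` lies only in `L^s` with `1/s = 1/p + 1/2`, and `u` is not admissible as a test function. One
tests instead with `T(u) g_n`, where `T` is a smooth bounded truncation. As `g_n A` is bounded, `g_n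
A ∇u` is in `L²` and its pairing with `∇T(u) = T'(u) ∇u` vanishes. What remains of `A` is `∫ T(u) A
∇u · ∇g_n = -∫ A ∇g_n · T(u) ∇u`. It makes sense because `2p/(p-2)` is the conjugate exponent of
`s`, and it tends to zero because `A ∇g_n → 0` weakly and `T(u) ∇u` is in `L²`. The other terms
converge by the remaining assumptions on `g_n`. This gives `energy_identity`, free of `A`; letting
`T` tend to the identity yields `energy_inequality`. Admissibility of `T(u) g_n` is proved in two
limits: `g_n` is mollified against a fixed test function
(`integral_mul_add_integral_inner_eq_zero`), then test functions `φ_j → u` in `H¹` are inserted in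
`T` (`integral_truncation_eq_zero`). For the drift, Sobolev's inequality and a splitting of `b` at a
large height give `‖v b‖² ≤ ‖∇v‖² + C‖v‖²` (`isFormBounded_of_inLp`). With Young's inequality the
gradients cancel, leaving `(λ - C/2)‖u‖² ≤ 0`. -/

/-- Euclidean space of dimension `d`. -/
abbrev Space (d : ℕ) : Type := EuclideanSpace ℝ (Fin d)

/-! ### Periodic functions, fundamental cells and translations -/

namespace FlatDomain
open scoped Pointwise

/-- The integer vectors, as a homomorphism into Euclidean space. -/
def latticeHom (d : ℕ) : (Fin d → ℤ) →+ Space d where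
  toFun k := WithLp.toLp 2 (fun i => (k i : ℝ))
  map_zero' := by ext i; simp
  map_add' k l := by ext i; simp

/-- The lattice `ℤ^d`. -/
def lattice (d : ℕ) : AddSubgroup (Space d) := (latticeHom d).range

/-- The group of translations by which the domain is a quotient of `ℝ^d`. -/
def group (M : FlatDomain) (d : ℕ) : AddSubgroup (Space d) :=
  match M with
  | euclidean => ⊥
  | torus => lattice d

/-- A fundamental cell of the domain. -/
def cell (M : FlatDomain) (d : ℕ) : Set (Space d) :=
  match M with
  | euclidean => Set.univ
  | torus => unitCell d

variable {d : ℕ} {M : FlatDomain} {F : Type*}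

instance : Countable (lattice d) := by
  have : (latticeHom d).range = lattice d := rfl
  exact (Set.countable_range (latticeHom d)).to_subtype

instance : Countable (M.group d) := by
  cases M
  · exact inferInstanceAs (Countable (⊥ : AddSubgroup (Space d)))
  · exact inferInstanceAs (Countable (lattice d))

lemma vol_eq : M.vol d = volume.restrict (M.cell d) := by
  cases M <;> simp [vol, cell]

/-- Both domains become quotients by a countable group with a fundamental domain, the group being
trivial for `ℝ^d`; most later arguments then need no case distinction. -/
lemma isFunction_iff {f : Space d → F} :
    M.IsFunction f ↔ ∀ (g : M.group d) x, f (g +ᵥ x) = f x := by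
  cases M
  · simp only [IsFunction, true_iff]
    rintro ⟨g, hg⟩ x
    obtain rfl : g = 0 := by simpa [group] using hg
    simp
  · constructor
    · rintro h ⟨g, k, rfl⟩ x
      have : f (latticeHom d k + x) = f x := by rw [add_comm]; exact h k x
      exact this
    · intro h k x
      rw [add_comm]
      exact h ⟨_, k, rfl⟩ x

lemma IsFunction.comp {F' : Type*} {f : Space d → F} (hf : M.IsFunction f) (T : F → F') :
    M.IsFunction (fun x => T (f x)) := by
  rw [isFunction_iff] at *
  simp [hf]

lemma IsFunction.comp₂ {F₁ F₂ F' : Type*} {f : Space d → F₁} {g : Space d → F₂}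
    (hf : M.IsFunction f) (hg : M.IsFunction g) (T : F₁ → F₂ → F') :
    M.IsFunction (fun x => T (f x) (g x)) := by
  rw [isFunction_iff] at *
  simp [hf, hg]

lemma IsFunction.const (c : F) : M.IsFunction (fun _ : Space d => c) := by
  rw [isFunction_iff]; simp

lemma IsFunction.add_right {f : Space d → F} (hf : M.IsFunction f) (y : Space d) :
    M.IsFunction (fun x => f (x + y)) := by
  rw [isFunction_iff] at *
  intro g x
  rw [← hf g (x + y)]
  simp [AddSubgroup.vadd_def, add_assoc]

lemma unitCell_eq_preimage (d : ℕ) :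
    unitCell d = (fun x : Space d => x.ofLp) ⁻¹' Set.pi Set.univ fun _ => Set.Ico (0 : ℝ) 1 := by
  ext x; simp [unitCell]

lemma measurableSet_unitCell (d : ℕ) : MeasurableSet (unitCell d) := by
  rw [unitCell_eq_preimage]
  exact (WithLp.measurable_ofLp 2 (Fin d → ℝ)) (MeasurableSet.univ_pi fun _ => measurableSet_Ico)

lemma norm_le_of_mem_unitCell {x : Space d} (hx : x ∈ unitCell d) : ‖x‖ ≤ √d := by
  rw [EuclideanSpace.norm_eq]
  apply Real.sqrt_le_sqrt
  calc ∑ i, ‖x i‖ ^ 2 ≤ ∑ _i : Fin d, (1 : ℝ) := by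
        refine Finset.sum_le_sum fun i _ => ?_
        have := hx i
        rw [Real.norm_eq_abs, sq_abs]
        nlinarith [this.1, this.2]
    _ = d := by simp

lemma isBounded_unitCell (d : ℕ) : Bornology.IsBounded (unitCell d) :=
  isBounded_iff_forall_norm_le.2 ⟨_, fun _ hx => norm_le_of_mem_unitCell hx⟩

lemma existsUnique_vadd_mem_unitCell (x : Space d) : ∃! g : lattice d, g +ᵥ x ∈ unitCell d := by
  refine ⟨⟨latticeHom d (fun i => -⌊x i⌋), _, rfl⟩, ?_, ?_⟩
  · intro i
    simp [AddSubgroup.mk_vadd, latticeHom, Int.floor_le, (Int.lt_floor_add_one _),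
      neg_add_lt_iff_lt_add]
  · rintro ⟨_, k, rfl⟩ hk
    have : k = fun i => -⌊x i⌋ := by
      ext i
      have := hk i
      simp only [AddSubgroup.mk_vadd, latticeHom, vadd_eq_add, AddMonoidHom.coe_mk, ZeroHom.coe_mk,
        PiLp.add_apply, Set.mem_Ico] at this
      have h : ⌊x i⌋ = -k i := by
        rw [Int.floor_eq_iff]; push_cast; constructor <;> linarith [this.1, this.2]
      omega
    simp [this]

lemma isAddFundamentalDomain_unitCell (d : ℕ) :
    IsAddFundamentalDomain (lattice d) (unitCell d) (volume : Measure (Space d)) :=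
  IsAddFundamentalDomain.mk' (measurableSet_unitCell d).nullMeasurableSet
    existsUnique_vadd_mem_unitCell

lemma isAddFundamentalDomain_cell :
    IsAddFundamentalDomain (M.group d) (M.cell d) (volume : Measure (Space d)) := by
  cases M
  · refine IsAddFundamentalDomain.mk' MeasurableSet.univ.nullMeasurableSet fun x => ?_
    refine ⟨0, Set.mem_univ _, fun g _ => ?_⟩
    have := g.2
    simpa [group] using this
  · exact isAddFundamentalDomain_unitCell d

lemma isAddFundamentalDomain_vadd_cell (y : Space d) :
    IsAddFundamentalDomain (M.group d) (y +ᵥ M.cell d) (volume : Measure (Space d)) :=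
  isAddFundamentalDomain_cell.vadd_of_comm y

/-- A translated cell is again a fundamental domain, and an invariant function has the same integral
over any two of them. -/
lemma lintegral_add_right {f : Space d → ℝ≥0∞} (hf : M.IsFunction f) (y : Space d) :
    ∫⁻ x, f (x + y) ∂M.vol d = ∫⁻ x, f x ∂M.vol d := by
  rw [vol_eq, ← IsAddFundamentalDomain.setLIntegral_eq (isAddFundamentalDomain_vadd_cell (M := M) y)
    isAddFundamentalDomain_cell f (isFunction_iff.1 hf)]
  have h := (measurePreserving_add_right (volume : Measure (Space d)) y).setLIntegral_comp_preimage_emb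
    (MeasurableEquiv.addRight y).measurableEmbedding f (y +ᵥ M.cell d)
  rw [← h]
  congr 2
  ext x
  simp [Set.mem_vadd_set_iff_neg_vadd_mem]

lemma integral_add_right [NormedAddCommGroup F] [NormedSpace ℝ F] {f : Space d → F}
    (hf : M.IsFunction f) (y : Space d) :
    ∫ x, f (x + y) ∂M.vol d = ∫ x, f x ∂M.vol d := by
  rw [vol_eq, ← IsAddFundamentalDomain.setIntegral_eq (isAddFundamentalDomain_vadd_cell (M := M) y)
    isAddFundamentalDomain_cell (isFunction_iff.1 hf)]
  have h := (measurePreserving_add_right (volume : Measure (Space d)) y).setIntegral_preimage_emb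
    (MeasurableEquiv.addRight y).measurableEmbedding f (y +ᵥ M.cell d)
  rw [← h]
  congr 2
  ext x
  simp [Set.mem_vadd_set_iff_neg_vadd_mem]

lemma vol_absolutelyContinuous : M.vol d ≪ volume := by
  rw [vol_eq]; exact Measure.absolutelyContinuous_of_le Measure.restrict_le_self

lemma vol_le_volume : M.vol d ≤ volume := by
  rw [vol_eq]; exact Measure.restrict_le_self

instance : SFinite (M.vol d) := by rw [vol_eq]; infer_instance

instance : IsLocallyFiniteMeasure (M.vol d) := by rw [vol_eq]; infer_instance

instance : IsFiniteMeasure (torus.vol d) :=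
  ⟨by simpa [vol] using (isBounded_unitCell d).measure_lt_top⟩

/-- Countably many translates of the cell cover `ℝ^d`, and invariance copies measurability from one
to all. Convolutions need this, since they see values outside the cell. -/
lemma aestronglyMeasurable_volume [TopologicalSpace F] [TopologicalSpace.PseudoMetrizableSpace F]
    {f : Space d → F} (hf : M.IsFunction f)
    (h : AEStronglyMeasurable f (M.vol d)) : AEStronglyMeasurable f volume := by
  rw [← (isAddFundamentalDomain_cell (M := M) (d := d)).sum_restrict,
    aestronglyMeasurable_sum_measure_iff]
  intro g
  rw [(isAddFundamentalDomain_cell (M := M)).vadd g |>.aestronglyMeasurable_on_iff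
    isAddFundamentalDomain_cell (isFunction_iff.1 hf), ← vol_eq]
  exact h

lemma IsFunction.aestronglyMeasurable_add_right [TopologicalSpace F]
    [TopologicalSpace.PseudoMetrizableSpace F] {f : Space d → F} (hf : M.IsFunction f)
    (h : AEStronglyMeasurable f (M.vol d)) (y : Space d) :
    AEStronglyMeasurable (fun x => f (x + y)) (M.vol d) :=
  ((aestronglyMeasurable_volume hf h).comp_measurePreserving
    (measurePreserving_add_right volume y)).mono_measure vol_le_volume

/-- A bounded set is covered by finitely many translates of the cell of the torus. -/
lemma exists_finset_lattice_cover {Q : Set (Space d)} (hQ : Bornology.IsBounded Q) :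
    ∃ S : Finset (lattice d), ∀ x ∈ Q, ∀ g : lattice d, g +ᵥ x ∈ unitCell d → g ∈ S := by
  obtain ⟨R, hR⟩ := hQ.exists_norm_le
  have hfin : (Set.range fun k : Fintype.piFinset fun _ : Fin d => Finset.Icc (-⌈R + 1⌉) ⌈R + 1⌉ =>
      (⟨latticeHom d k, k, rfl⟩ : lattice d)).Finite := Set.finite_range _
  refine ⟨hfin.toFinset, fun x hx g hg => ?_⟩
  obtain ⟨_, k, rfl⟩ := g
  rw [Set.Finite.mem_toFinset]
  refine ⟨⟨k, ?_⟩, rfl⟩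
  rw [Fintype.mem_piFinset]
  intro i
  have h1 := hg i
  have h2 : |x i| ≤ R := (PiLp.norm_apply_le x i).trans (hR x hx)
  simp only [AddSubgroup.mk_vadd, latticeHom, vadd_eq_add, AddMonoidHom.coe_mk, ZeroHom.coe_mk,
    PiLp.add_apply, Set.mem_Ico] at h1
  have h3 := abs_le.1 h2
  have h4 := Int.le_ceil (R + 1)
  rw [Finset.mem_Icc]
  constructor
  · have : (-⌈R + 1⌉ : ℝ) ≤ k i := by linarith
    exact_mod_cast this
  · have : (k i : ℝ) ≤ ⌈R + 1⌉ := by linarith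
    exact_mod_cast this

/-- A bounded set meets finitely many cells, each carrying the same integral; `N` counts them and
does not depend on `f`. -/
lemma exists_nat_setLIntegral_le {Q : Set (Space d)} (hQ : Bornology.IsBounded Q) :
    ∃ N : ℕ, ∀ f : Space d → ℝ≥0∞, torus.IsFunction f →
      ∫⁻ x in Q, f x ≤ N * ∫⁻ x, f x ∂torus.vol d := by
  obtain ⟨S, hS⟩ := exists_finset_lattice_cover hQ
  refine ⟨S.card, fun f hf => ?_⟩
  have hf' : ∀ (g : lattice d) x, f (g +ᵥ x) = f x := isFunction_iff.1 hf
  calc ∫⁻ x in Q, f x ≤ ∫⁻ x, f x ∂Measure.sum fun g : S => volume.restrict (-g.1 +ᵥ unitCell d) := by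
        refine lintegral_mono' ?_ le_rfl
        refine (Measure.restrict_mono ?_ le_rfl).trans Measure.restrict_iUnion_le
        intro x hx
        obtain ⟨g, hg, -⟩ := existsUnique_vadd_mem_unitCell x
        rw [Set.mem_iUnion]
        exact ⟨⟨g, hS x hx g hg⟩, by rwa [Set.mem_vadd_set_iff_neg_vadd_mem, neg_neg]⟩
    _ = S.card * ∫⁻ x, f x ∂torus.vol d := by
        rw [lintegral_sum_measure, tsum_fintype,
          Finset.sum_congr rfl (g := fun _ => ∫⁻ x, f x ∂torus.vol d), Finset.sum_const,
          nsmul_eq_mul]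
        · simp
        intro g _
        exact ((isAddFundamentalDomain_unitCell d).vadd (-g.1)).setLIntegral_eq
          (isAddFundamentalDomain_unitCell d) f hf'

lemma InLp.locallyIntegrable [NormedAddCommGroup F] {f : Space d → F} {p : ℝ≥0∞}
    (hf : M.InLp f p) (hp : 1 ≤ p) : LocallyIntegrable f volume := by
  cases M
  · exact hf.2.locallyIntegrable hp
  · have hm := aestronglyMeasurable_volume hf.1 hf.2.1
    have h1 := (hf.2.integrable hp).2
    rw [locallyIntegrable_iff]
    intro K hK
    refine ⟨hm.restrict, ?_⟩
    obtain ⟨N, hN⟩ := exists_nat_setLIntegral_le hK.isBounded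
    exact (hN _ (hf.1.comp fun y => ‖y‖ₑ)).trans_lt (ENNReal.mul_lt_top (by simp) h1)

lemma InLp.add_right [NormedAddCommGroup F] {f : Space d → F} {p : ℝ≥0∞}
    (hf : M.InLp f p) (hp0 : p ≠ 0) (hp : p ≠ ⊤) (y : Space d) :
    M.InLp (fun x => f (x + y)) p := by
  refine ⟨hf.1.add_right y, hf.1.aestronglyMeasurable_add_right hf.2.1 y, ?_⟩
  have h := hf.2.2
  rw [eLpNorm_lt_top_iff_lintegral_rpow_enorm_lt_top hp0 hp] at *
  rwa [lintegral_add_right (hf.1.comp fun y => ‖y‖ₑ ^ p.toReal) y]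

lemma eLpNorm_add_right [NormedAddCommGroup F] {f : Space d → F} {p : ℝ≥0∞}
    (hf : M.IsFunction f) (hp0 : p ≠ 0) (hp : p ≠ ⊤) (y : Space d) :
    eLpNorm (fun x => f (x + y)) p (M.vol d) = eLpNorm f p (M.vol d) := by
  rw [eLpNorm_eq_lintegral_rpow_enorm_toReal hp0 hp, eLpNorm_eq_lintegral_rpow_enorm_toReal hp0 hp,
    lintegral_add_right (hf.comp fun y => ‖y‖ₑ ^ p.toReal) y]

/-- Translation is continuous in `L^p`. -/
lemma _root_.MeasureTheory.MemLp.tendsto_eLpNorm_translate_sub [NormedAddCommGroup F]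
    {f : Space d → F} {p : ℝ≥0∞} (hf : MemLp f p volume) (hp1 : 1 ≤ p) (hp : p ≠ ⊤) :
    Tendsto (fun y => eLpNorm (fun x => f (x + y) - f x) p volume) (𝓝 0) (𝓝 0) := by
  have : Fact (1 ≤ p) := ⟨hp1⟩
  let g : Space d → C(Space d, Space d) := fun y => ⟨fun x => x + y, by fun_prop⟩
  have hg : Continuous g := by
    refine ContinuousMap.continuous_of_continuous_uncurry _ ?_
    change Continuous fun z : Space d × Space d => z.2 + z.1
    fun_prop
  have hgm : ∀ y, MeasurePreserving (g y) (volume : Measure (Space d)) volume := fun y =>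
    measurePreserving_add_right volume y
  have h := (continuous_const (y := hf.toLp f)).compMeasurePreservingLp hg hgm hp
  have h0 := h.tendsto 0
  rw [Lp.tendsto_Lp_iff_tendsto_eLpNorm'] at h0
  refine h0.congr fun y => eLpNorm_congr_ae ?_
  simp only [Lp.toLp_compMeasurePreserving]
  filter_upwards [(hf.comp_measurePreserving (hgm y)).coeFn_toLp,
    (hf.comp_measurePreserving (hgm 0)).coeFn_toLp] with x h1 h2
  rw [Pi.sub_apply, h1, h2]
  simp [g]

lemma InLp.tendsto_eLpNorm_translate_sub [NormedAddCommGroup F]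
    {f : Space d → F} {p : ℝ≥0∞} (hf : M.InLp f p) (hp1 : 1 ≤ p) (hp : p ≠ ⊤) :
    Tendsto (fun y => eLpNorm (fun x => f (x + y) - f x) p (M.vol d)) (𝓝 0) (𝓝 0) := by
  have hp0 : p ≠ 0 := (one_pos.trans_le hp1).ne'
  cases M
  · exact hf.2.tendsto_eLpNorm_translate_sub hp1 hp
  -- For `x` in the cell and `‖y‖ < 1`, both `x` and `x + y` lie in `Q`, so cutting `f` off outside
  -- `Q` changes nothing and the result on `ℝ^d` applies.
  · set Q := Metric.ball (0 : Space d) (√d + 1)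
    have hQ : MemLp (Q.indicator f) p volume := by
      rw [memLp_indicator_iff_restrict Metric.isOpen_ball.measurableSet]
      refine ⟨(aestronglyMeasurable_volume hf.1 hf.2.1).restrict, ?_⟩
      have h := hf.2.2
      rw [eLpNorm_lt_top_iff_lintegral_rpow_enorm_lt_top hp0 hp] at *
      obtain ⟨N, hN⟩ := exists_nat_setLIntegral_le (Metric.isBounded_ball (x := (0 : Space d))
        (r := √d + 1))
      exact (hN _ (hf.1.comp fun y => ‖y‖ₑ ^ p.toReal)).trans_lt (ENNReal.mul_lt_top (by simp) h)
    have h := hQ.tendsto_eLpNorm_translate_sub hp1 hp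
    refine tendsto_of_tendsto_of_tendsto_of_le_of_le' tendsto_const_nhds h
      (Eventually.of_forall fun _ => zero_le) ?_
    filter_upwards [Metric.ball_mem_nhds (0 : Space d) one_pos] with y hy
    refine le_trans (eLpNorm_congr_ae ?_).le
      (eLpNorm_mono_measure _ (vol_le_volume (M := torus) (d := d)))
    filter_upwards [ae_restrict_mem (measurableSet_unitCell d)] with x hx
    have hx' := norm_le_of_mem_unitCell hx
    have h1 : x ∈ Q := by simp only [Q, mem_ball_zero_iff]; linarith
    have h2 : x + y ∈ Q := by
      simp only [Q, mem_ball_zero_iff] at hy ⊢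
      linarith [norm_add_le x y]
    simp [h1, h2]

end FlatDomain

/-! ### Periodization, and weak gradients on the torus as weak gradients on `ℝ^d` -/

namespace FlatDomain
open scoped Pointwise
variable {d : ℕ} {M : FlatDomain} {F : Type*}

lemma gradient_apply (φ : Space d → ℝ) (x : Space d) (i : Fin d) :
    gradient φ x i = fderiv ℝ φ x (EuclideanSpace.single i 1) := by
  rw [← inner_gradient_left, EuclideanSpace.inner_single_right]
  simp

lemma exists_finset_lattice_norm_le (R : ℝ) :
    ∃ S : Finset (lattice d), ∀ g : lattice d, ‖(g : Space d)‖ ≤ R → g ∈ S := by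
  obtain ⟨S, hS⟩ := exists_finset_lattice_cover (d := d)
    (Metric.isBounded_closedBall (x := (0 : Space d)) (r := R))
  refine ⟨S, fun g hg => hS (-g) (by simpa using hg) g fun i => ?_⟩
  simp [AddSubgroup.vadd_def]

/-- The sum of all lattice translates of a function. -/
noncomputable def periodize (φ : Space d → ℝ) (x : Space d) : ℝ := ∑ᶠ g : lattice d, φ (g +ᵥ x)

lemma isFunction_periodize (φ : Space d → ℝ) : torus.IsFunction (periodize φ) := by
  rw [isFunction_iff]
  intro (h : lattice d) x
  unfold periodize
  rw [← finsum_comp_equiv (Equiv.addRight h) (f := fun g : lattice d => φ (g +ᵥ x))]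
  simp only [Equiv.coe_addRight, add_vadd]
  rfl

/-- On a ball only finitely many translates of a compactly supported function are nonzero. The
`finsum` is thus a genuine finite sum there, with one index set for the whole ball, which allows
differentiation term by term. -/
lemma exists_finset_periodize_eq {φ : Space d → ℝ} (hφ : HasCompactSupport φ) (R : ℝ) :
    ∃ S : Finset (lattice d), ∀ x, ‖x‖ < R →
      (∀ g, φ (g +ᵥ x) ≠ 0 → g ∈ S) ∧ periodize φ x = ∑ g ∈ S, φ (g +ᵥ x) := by
  obtain ⟨r, hr⟩ := hφ.isBounded.exists_norm_le
  obtain ⟨S, hS⟩ := exists_finset_lattice_norm_le (d := d) (R + r)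
  refine ⟨S, fun x hx => ?_⟩
  have h : ∀ g : lattice d, φ (g +ᵥ x) ≠ 0 → g ∈ S := fun g hg => by
    apply hS
    have h1 := hr _ (subset_tsupport _ hg)
    have h2 : (g : Space d) = (g +ᵥ x) - x := by simp [AddSubgroup.vadd_def]
    rw [h2]
    linarith [norm_sub_le (g +ᵥ x) x]
  exact ⟨h, finsum_eq_sum_of_support_subset _ fun g hg => h g hg⟩

lemma contDiff_periodize {φ : Space d → ℝ} (hφ : ContDiff ℝ ∞ φ) (hc : HasCompactSupport φ) :
    ContDiff ℝ ∞ (periodize φ) := by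
  rw [contDiff_iff_contDiffAt]
  intro x
  obtain ⟨S, hS⟩ := exists_finset_periodize_eq hc (‖x‖ + 1)
  have h : periodize φ =ᶠ[𝓝 x] fun y => ∑ g ∈ S, φ (g +ᵥ y) := by
    filter_upwards [(isOpen_lt continuous_norm continuous_const).mem_nhds
      (show ‖x‖ < ‖x‖ + 1 by linarith)] with y hy
    exact (hS y hy).2
  refine ContDiffAt.congr_of_eventuallyEq ?_ h
  refine ContDiffAt.sum fun g _ => ?_
  simp only [AddSubgroup.vadd_def, vadd_eq_add]
  exact (hφ.comp (contDiff_const.add contDiff_id)).contDiffAt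

lemma fderiv_periodize {φ : Space d → ℝ} (hφ : ContDiff ℝ ∞ φ) (hc : HasCompactSupport φ)
    (x v : Space d) :
    fderiv ℝ (periodize φ) x v = periodize (fun y => fderiv ℝ φ y v) x := by
  obtain ⟨S, hS⟩ := exists_finset_periodize_eq hc (‖x‖ + 1)
  have h : periodize φ =ᶠ[𝓝 x] fun y => ∑ g ∈ S, φ (g +ᵥ y) := by
    filter_upwards [(isOpen_lt continuous_norm continuous_const).mem_nhds
      (show ‖x‖ < ‖x‖ + 1 by linarith)] with y hy
    exact (hS y hy).2
  have hd : ∀ g : lattice d, HasFDerivAt (fun y => φ (g +ᵥ y)) (fderiv ℝ φ (g +ᵥ x)) x := by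
    intro g
    exact (hasFDerivAt_comp_add_left (g : Space d)).2
      (hφ.differentiable (by simp)).differentiableAt.hasFDerivAt
  rw [h.fderiv_eq, (HasFDerivAt.fun_sum fun g _ => hd g).fderiv, sum_apply]
  refine (finsum_eq_sum_of_support_subset _ fun g hg => ?_).symm
  -- A translate with index outside `S` vanishes in a neighbourhood of `x`, hence so does its
  -- derivative at `x`.
  by_contra hgS
  apply hg
  have : (fun y => φ (g +ᵥ y)) =ᶠ[𝓝 x] fun _ => 0 := by
    filter_upwards [(isOpen_lt continuous_norm continuous_const).mem_nhds
      (show ‖x‖ < ‖x‖ + 1 by linarith)] with y hy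
    by_contra h0
    exact hgS ((hS y hy).1 g h0)
  have h2 := this.fderiv_eq (𝕜 := ℝ)
  rw [(hd g).fderiv] at h2
  simp only [h2, fderiv_fun_const, Pi.zero_apply, zero_apply]

/-- Unfolding: the integral over `ℝ^d` splits into integrals over translated cells, and periodicity
of `f` pulls it out of the sum. -/
lemma integral_mul_eq_integral_mul_periodize {f ψ : Space d → ℝ} (hf : torus.IsFunction f)
    (hfi : LocallyIntegrable f volume) (hψ : Continuous ψ) (hc : HasCompactSupport ψ) :
    ∫ x, f x * ψ x = ∫ x, f x * periodize ψ x ∂torus.vol d := by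
  obtain ⟨S, hS⟩ := exists_finset_periodize_eq hc (√d + 1)
  have hint : Integrable (fun x => f x * ψ x) volume := by
    simpa [mul_comm] using hfi.integrable_smul_left_of_hasCompactSupport hψ hc
  have hf' : ∀ (g : lattice d) x, f (g +ᵥ x) = f x := isFunction_iff.1 hf
  rw [(isAddFundamentalDomain_unitCell d).integral_eq_tsum'' _ hint]
  have hlt : ∀ x ∈ unitCell d, ‖x‖ < √d + 1 := fun x hx => by
    linarith [norm_le_of_mem_unitCell hx]
  rw [tsum_eq_sum (s := S)]
  · rw [← integral_finsetSum]
    · refine setIntegral_congr_fun (measurableSet_unitCell d) fun x hx => ?_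
      simp only [hf', (hS x (hlt x hx)).2, Finset.mul_sum]
    · intro g _
      have h2 : Integrable (fun x => f (g +ᵥ x) * ψ (g +ᵥ x)) volume := by
        simp only [AddSubgroup.vadd_def, vadd_eq_add]
        exact hint.comp_add_left (g : Space d)
      exact h2.restrict
  · intro g hg
    rw [← integral_zero (Space d) ℝ (μ := volume.restrict (unitCell d))]
    refine setIntegral_congr_fun (measurableSet_unitCell d) fun x hx => ?_
    have : ψ (g +ᵥ x) = 0 := by
      by_contra h
      exact hg ((hS x (hlt x hx)).1 g h)
    simp [this]

/-- A weak gradient on the domain is a weak gradient on `ℝ^d`. -/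
lemma HasWeakGradient.integral_mul_fderiv {f : Space d → ℝ} {G : Space d → Space d}
    (h : M.HasWeakGradient f G) (hf : LocallyIntegrable f volume) (hG : LocallyIntegrable G volume)
    {φ : Space d → ℝ} (hφ : ContDiff ℝ ∞ φ) (hc : HasCompactSupport φ) (i : Fin d) :
    ∫ x, f x * fderiv ℝ φ x (EuclideanSpace.single i 1) = - ∫ x, G x i * φ x := by
  cases M
  · have := h.2.2.2.2 φ ⟨hφ, trivial, hc⟩ i
    simp only [gradient_apply] at this
    exact this
  · have hGi : LocallyIntegrable (fun x => G x i) volume :=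
      fun x => (hG x).imp fun s ⟨hs, hi⟩ => ⟨hs,
        (EuclideanSpace.proj (𝕜 := ℝ) i).integrable_comp hi⟩
    -- Both integrals fold onto the cell, where the periodization of `φ` is an admissible test
    -- function on the torus.
    rw [integral_mul_eq_integral_mul_periodize h.1 hf
      ((hφ.continuous_fderiv (by simp)).clm_apply continuous_const) (hc.fderiv_apply ℝ _),
      integral_mul_eq_integral_mul_periodize (h.2.1.comp fun v => v i) hGi hφ.continuous hc]
    have := h.2.2.2.2 (periodize φ) ⟨contDiff_periodize hφ hc, isFunction_periodize φ, trivial⟩ i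
    simpa only [gradient_apply, fderiv_periodize hφ hc] using this

end FlatDomain

/-! ### Mollification -/

namespace FlatDomain
open scoped Pointwise
variable {d : ℕ} {M : FlatDomain} {F : Type*}

/-- A bump function at the origin supported in the ball of radius `2 / (j + 1)`. -/
noncomputable def mollifier (d j : ℕ) : ContDiffBump (0 : Space d) where
  rIn := 1 / (j + 1)
  rOut := 2 / (j + 1)
  rIn_pos := by positivity
  rIn_lt_rOut := by gcongr; norm_num

lemma tendsto_mollifier_rOut (d : ℕ) : Tendsto (fun j => (mollifier d j).rOut) atTop (𝓝 0) := by
  have := (tendsto_one_div_add_atTop_nhds_zero_nat (𝕜 := ℝ)).const_mul 2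
  refine (by simpa using this : Tendsto (fun j : ℕ => 2 * ((j : ℝ) + 1)⁻¹) atTop (𝓝 0)).congr ?_
  intro j
  simp [mollifier, div_eq_mul_inv]

/-- The normalised mollification kernel. -/
noncomputable def kernel (d j : ℕ) : Space d → ℝ := (mollifier d j).normed volume

lemma contDiff_kernel (j : ℕ) : ContDiff ℝ ∞ (kernel d j) := (mollifier d j).contDiff_normed
lemma hasCompactSupport_kernel (j : ℕ) : HasCompactSupport (kernel d j) :=
  (mollifier d j).hasCompactSupport_normed
lemma kernel_nonneg (j : ℕ) (x : Space d) : 0 ≤ kernel d j x := (mollifier d j).nonneg_normed x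
lemma integral_kernel (j : ℕ) : ∫ x, kernel d j x = 1 := (mollifier d j).integral_normed
lemma integrable_kernel (j : ℕ) : Integrable (kernel d j) := (mollifier d j).integrable_normed

/-- Mollification of a function. -/
noncomputable def mollify [NormedAddCommGroup F] [NormedSpace ℝ F] (j : ℕ) (f : Space d → F)
    (x : Space d) : F := ∫ t, kernel d j t • f (x - t)

variable [NormedAddCommGroup F] [NormedSpace ℝ F]

lemma mollify_eq_convolution (j : ℕ) (f : Space d → F) :
    mollify j f = convolution (kernel d j) f (ContinuousLinearMap.lsmul ℝ ℝ) volume := rfl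

lemma IsFunction.mollify {f : Space d → F} (hf : M.IsFunction f) (j : ℕ) :
    M.IsFunction (mollify j f) := by
  rw [isFunction_iff] at *
  intro g x
  simp only [FlatDomain.mollify]
  congr 1; ext t
  rw [← hf g (x - t)]
  simp [AddSubgroup.vadd_def, add_sub_assoc]

lemma contDiff_mollify {f : Space d → F} (hf : LocallyIntegrable f volume) (j : ℕ) :
    ContDiff ℝ ∞ (mollify j f) := by
  rw [mollify_eq_convolution]
  exact (hasCompactSupport_kernel j).contDiff_convolution_left _ (contDiff_kernel j) hf

lemma mollify_eq_integral_sub (f : Space d → F) (j : ℕ) (x : Space d) :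
    mollify j f x = ∫ t, kernel d j (x - t) • f t := by
  rw [mollify, ← integral_sub_left_eq_self _ volume x]
  simp

/-- The derivative falls on the kernel, and `t ↦ kernel d j (x - t)` serves as test function for the
weak gradient; the sign from the reflection cancels the sign in the definition of the weak gradient.
-/
lemma gradient_mollify {f : Space d → ℝ} {G : Space d → Space d} (h : M.HasWeakGradient f G)
    (hf : LocallyIntegrable f volume) (hG : LocallyIntegrable G volume) (j : ℕ) (x : Space d) :
    gradient (mollify j f) x = mollify j G x := by
  ext i
  have hk := (contDiff_kernel (d := d) j)
  have hc := hasCompactSupport_kernel (d := d) j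
  have h1 := hc.hasFDerivAt_convolution_left (ContinuousLinearMap.lsmul ℝ ℝ) (μ := volume)
    (hk.of_le (by simp)) hf x
  rw [gradient_apply, mollify_eq_convolution, h1.fderiv, convolution_eq_swap]
  have hint : Integrable (fun t => (((ContinuousLinearMap.lsmul ℝ ℝ).precompL (Space d))
      (fderiv ℝ (kernel d j) (x - t))) (f t)) volume := by
    have := (hc.fderiv ℝ).convolutionExists_left
      ((ContinuousLinearMap.lsmul ℝ ℝ : ℝ →L[ℝ] ℝ →L[ℝ] ℝ).precompL (Space d))
      (hk.continuous_fderiv (by simp)) hf x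
    exact (convolutionExistsAt_iff_integrable_swap).1 this
  rw [ContinuousLinearMap.integral_apply hint]
  have hφc : HasCompactSupport (fun t => kernel d j (x - t)) :=
    hc.comp_homeomorph (Homeomorph.subLeft x)
  have hφ : ContDiff ℝ ∞ (fun t => kernel d j (x - t)) :=
    hk.comp (contDiff_const.sub contDiff_id)
  have h2 := h.integral_mul_fderiv hf hG hφ hφc i
  have h3 : ∀ t, fderiv ℝ (fun t => kernel d j (x - t)) t = - fderiv ℝ (kernel d j) (x - t) :=
    fun t => by
      have := ((hk.differentiable (by simp)).differentiableAt (x := x - t)).hasFDerivAt.comp t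
        ((hasFDerivAt_id t).const_sub x)
      rw [show (fun t => kernel d j (x - t)) = kernel d j ∘ HSub.hSub x from rfl, this.fderiv]
      ext v; simp
  simp only [h3, neg_apply, mul_neg, integral_neg, neg_inj] at h2
  have hG' : Integrable (fun t => kernel d j (x - t) • G t) :=
    hG.integrable_smul_left_of_hasCompactSupport hφ.continuous hφc
  rw [mollify_eq_integral_sub]
  change _ = EuclideanSpace.proj (𝕜 := ℝ) i (∫ t, kernel d j (x - t) • G t)
  rw [← ContinuousLinearMap.integral_comp_comm _ hG']
  simpa [mul_comm] using h2

end FlatDomain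

/-! ### Convergence of mollifications, weakly against `L^p` and strongly in `L²` -/

namespace FlatDomain
open scoped Pointwise
variable {d : ℕ} {M : FlatDomain} {V : Type*} [NormedAddCommGroup V] [InnerProductSpace ℝ V]

lemma eLpNorm_inner_le {α : Type*} {m : MeasurableSpace α} {μ : Measure α} {A B : α → V}
    {p q r : ℝ≥0∞} [ENNReal.HolderTriple p q r]
    (hA : AEStronglyMeasurable A μ) (hB : AEStronglyMeasurable B μ) :
    eLpNorm (fun x => inner ℝ (A x) (B x)) r μ ≤ eLpNorm A p μ * eLpNorm B q μ := by
  have := eLpNorm_le_eLpNorm_mul_eLpNorm_of_nnnorm (p := p) (q := q) (r := r) hA hB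
    (fun a b => inner ℝ a b) 1 (Eventually.of_forall fun x => by
      rw [one_mul]; exact nnnorm_inner_le_nnnorm _ _)
  simpa using this

lemma memLp_inner {α : Type*} {m : MeasurableSpace α} {μ : Measure α} {A B : α → V}
    {p q : ℝ≥0∞} (r : ℝ≥0∞) [ENNReal.HolderTriple p q r] (hA : MemLp A p μ) (hB : MemLp B q μ) :
    MemLp (fun x => inner ℝ (A x) (B x)) r μ :=
  ⟨hA.1.inner hB.1, (eLpNorm_inner_le (p := p) (q := q) hA.1 hB.1).trans_lt
    (ENNReal.mul_lt_top hA.2 hB.2)⟩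

lemma integrable_inner {α : Type*} {m : MeasurableSpace α} {μ : Measure α} {A B : α → V}
    {p q : ℝ≥0∞} [ENNReal.HolderConjugate p q] (hA : MemLp A p μ) (hB : MemLp B q μ) :
    Integrable (fun x => inner ℝ (A x) (B x)) μ :=
  memLp_one_iff_integrable.1 (memLp_inner 1 hA hB)

lemma enorm_integral_inner_le {α : Type*} {m : MeasurableSpace α} {μ : Measure α} {A B : α → V}
    (p q : ℝ≥0∞) [ENNReal.HolderConjugate p q] (hA : AEStronglyMeasurable A μ)
    (hB : AEStronglyMeasurable B μ) :
    ‖∫ x, inner ℝ (A x) (B x) ∂μ‖ₑ ≤ eLpNorm A p μ * eLpNorm B q μ := by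
  refine (enorm_integral_le_lintegral_enorm _).trans ?_
  rw [← eLpNorm_one_eq_lintegral_enorm]
  exact eLpNorm_inner_le hA hB

/-- Hölder's inequality and continuity of translation in `L^p`. Only `f` is translated, so `q = ∞`
is allowed; this is the case needed for the bounded cutoffs. -/
lemma continuous_integral_inner_translate {f G : Space d → V} {p q : ℝ≥0∞}
    [ENNReal.HolderConjugate p q] (hp : p ≠ ⊤) (hf : M.InLp f p) (hG : M.InLp G q) :
    Continuous fun y => ∫ x, inner ℝ (f (x + y)) (G x) ∂M.vol d := by
  have hp1 : 1 ≤ p := ENNReal.HolderConjugate.one_le p q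
  have hp0 : p ≠ 0 := (one_pos.trans_le hp1).ne'
  rw [continuous_iff_continuousAt]
  intro y₀
  have hf' := hf.add_right hp0 hp y₀
  have h1 := hf'.tendsto_eLpNorm_translate_sub hp1 hp
  have h2 : Tendsto (fun y => y - y₀) (𝓝 y₀) (𝓝 0) := by
    have : Continuous fun y : Space d => y - y₀ := by fun_prop
    simpa using this.tendsto y₀
  have h3 := ENNReal.Tendsto.mul_const (h1.comp h2) (Or.inr hG.2.2.ne)
  rw [zero_mul] at h3
  rw [ContinuousAt, tendsto_iff_edist_tendsto_0]
  refine tendsto_of_tendsto_of_tendsto_of_le_of_le tendsto_const_nhds h3 (fun _ => zero_le)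
    fun y => ?_
  have hy := hf.add_right hp0 hp y
  rw [edist_eq_enorm_sub, ← integral_sub (integrable_inner hy.2 hG.2) (integrable_inner hf'.2 hG.2)]
  simp only [← inner_sub_left]
  refine (enorm_integral_inner_le p q (hy.2.1.sub hf'.2.1) hG.2.1).trans (le_of_eq ?_)
  simp [add_assoc]
  rfl

lemma aestronglyMeasurable_comp_sub {V : Type*} [NormedAddCommGroup V] {G : Space d → V} (hG : M.IsFunction G)
    (hm : AEStronglyMeasurable G (M.vol d)) {ν : Measure (Space d)} [SFinite ν] (hν : ν ≪ volume) :
    AEStronglyMeasurable (fun z : Space d × Space d => G (z.1 - z.2)) ((M.vol d).prod ν) :=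
  ((aestronglyMeasurable_volume hG hm).comp_quasiMeasurePreserving
    (quasiMeasurePreserving_sub volume volume)).mono_ac
    (vol_absolutelyContinuous.prod hν)

/-- The hypothesis of Fubini's theorem: by translation invariance, the Hölder bound of the inner
integral is uniform in the shift `t`. -/
lemma integrable_kernel_mul_inner {f G : Space d → V} {p q : ℝ≥0∞}
    [ENNReal.HolderConjugate p q] (hp : p ≠ ⊤) (hf : M.InLp f p) (hG : M.InLp G q) (j : ℕ) :
    Integrable (fun z : Space d × Space d => kernel d j z.2 * inner ℝ (f z.1) (G (z.1 - z.2)))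
      ((M.vol d).prod volume) := by
  have hp1 : 1 ≤ p := ENNReal.HolderConjugate.one_le p q
  have hp0 : p ≠ 0 := (one_pos.trans_le hp1).ne'
  have hm : AEStronglyMeasurable (fun z : Space d × Space d =>
      kernel d j z.2 * inner ℝ (f z.1) (G (z.1 - z.2))) ((M.vol d).prod volume) :=
    ((contDiff_kernel j).continuous.comp continuous_snd).aestronglyMeasurable.mul
      (hf.2.1.comp_fst.inner
        (aestronglyMeasurable_comp_sub hG.1 hG.2.1 (Measure.AbsolutelyContinuous.refl _)))
  have hi : ∀ t : Space d, Integrable (fun x => inner ℝ (f x) (G (x - t))) (M.vol d) ∧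
      ∫ x, ‖inner ℝ (f x) (G (x - t))‖ ∂M.vol d ≤
        (eLpNorm f p (M.vol d) * eLpNorm G q (M.vol d)).toReal := by
    intro t
    have hm2 : AEStronglyMeasurable (fun x => inner ℝ (f x) (G (x - t))) (M.vol d) := by
      simp only [sub_eq_add_neg]
      exact hf.2.1.inner (hG.1.aestronglyMeasurable_add_right hG.2.1 _)
    have h1 : ∫⁻ x, ‖inner ℝ (f x) (G (x - t))‖ₑ ∂M.vol d ≤
        eLpNorm f p (M.vol d) * eLpNorm G q (M.vol d) := by
      simp only [sub_eq_add_neg]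
      rw [← eLpNorm_add_right hf.1 hp0 hp t,
        ← lintegral_add_right ((hf.1.comp₂ (hG.1.add_right (-t)) fun a b => ‖inner ℝ a b‖ₑ)) t]
      simp only [add_neg_cancel_right]
      rw [← eLpNorm_one_eq_lintegral_enorm]
      exact eLpNorm_inner_le (hf.1.aestronglyMeasurable_add_right hf.2.1 _) hG.2.1
    have h2 := ENNReal.mul_lt_top hf.2.2 hG.2.2
    refine ⟨⟨hm2, h1.trans_lt h2⟩, ?_⟩
    rw [integral_norm_eq_lintegral_enorm hm2]
    exact ENNReal.toReal_mono h2.ne h1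
  rw [integrable_prod_iff' hm]
  refine ⟨Eventually.of_forall fun t => (hi t).1.const_mul (kernel d j t), ?_⟩
  refine ((integrable_kernel j).mul_const
    (eLpNorm f p (M.vol d) * eLpNorm G q (M.vol d)).toReal).mono'
    hm.norm.prod_swap.integral_prod_right' (Eventually.of_forall fun t => ?_)
  simp only [norm_mul, integral_const_mul]
  simp only [Real.norm_of_nonneg (kernel_nonneg j t)]
  refine mul_le_mul_of_nonneg_left (le_trans (le_of_eq ?_) (hi t).2) (kernel_nonneg j t)
  exact Real.norm_of_nonneg (integral_nonneg fun x => norm_nonneg _)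

/-- Mollifications converge weakly. -/
lemma tendsto_integral_inner_mollify [CompleteSpace V] {f G : Space d → V} {p q : ℝ≥0∞}
    [ENNReal.HolderConjugate p q] (hp : p ≠ ⊤) (hf : M.InLp f p) (hG : M.InLp G q) :
    Tendsto (fun j => ∫ x, inner ℝ (f x) (mollify j G x) ∂M.vol d) atTop
      (𝓝 (∫ x, inner ℝ (f x) (G x) ∂M.vol d)) := by
  have hq1 : 1 ≤ q := ENNReal.HolderConjugate.one_le q p
  -- After exchanging the integrals and shifting by `t`, the pairing is the convolution at `0` of
  -- the kernel with a continuous function of the shift. The reflection accounts for the sign in the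
  -- convolution.
  have hcont := continuous_integral_inner_translate hp hf hG
  have hlim := ContDiffBump.convolution_tendsto_right_of_continuous (μ := volume)
    (tendsto_mollifier_rOut d) (hcont.comp continuous_neg) 0
  have h0 : ∫ x, inner ℝ (f x) (G x) ∂M.vol d
      = ((fun y => ∫ x, inner ℝ (f (x + y)) (G x) ∂M.vol d) ∘ Neg.neg) 0 := by simp
  rw [h0]
  refine hlim.congr fun j => ?_
  have hGl := hG.locallyIntegrable hq1
  have h1 : ∀ x, inner ℝ (f x) (mollify j G x) = ∫ t, kernel d j t * inner ℝ (f x) (G (x - t)) := by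
    intro x
    rw [mollify, ← integral_inner]
    · simp [inner_smul_right]
    · exact (hasCompactSupport_kernel j).convolutionExists_left (ContinuousLinearMap.lsmul ℝ ℝ)
        (contDiff_kernel j).continuous hGl x
  simp_rw [h1]
  rw [integral_integral_swap (integrable_kernel_mul_inner hp hf hG j)]
  refine Eq.trans
    (b := ∫ t, kernel d j t • ∫ x, inner ℝ (f (x + -(0 - t))) (G x) ∂M.vol d) rfl ?_
  congr 1; ext t
  rw [integral_const_mul, smul_eq_mul]
  congr 1
  simp only [sub_eq_add_neg]
  rw [← integral_add_right ((hf.1.comp₂ (hG.1.add_right (-t)) fun a b => inner ℝ a b)) t]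
  simp

/-- The probability measure with density the mollification kernel. -/
noncomputable def kernelMeasure (d j : ℕ) : Measure (Space d) :=
  volume.withDensity fun t => ENNReal.ofReal (kernel d j t)

instance (j : ℕ) : IsProbabilityMeasure (kernelMeasure d j) := ⟨by
  rw [kernelMeasure, withDensity_apply _ MeasurableSet.univ, Measure.restrict_univ,
    ← ofReal_integral_eq_lintegral_ofReal (integrable_kernel j)
      (Eventually.of_forall (kernel_nonneg j)), integral_kernel, ENNReal.ofReal_one]⟩

lemma kernelMeasure_absolutelyContinuous (j : ℕ) : kernelMeasure d j ≪ volume :=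
  withDensity_absolutelyContinuous _ _

lemma aestronglyMeasurable_mollify {G : Space d → V} (hG : LocallyIntegrable G volume) (j : ℕ)
    {μ : Measure (Space d)} : AEStronglyMeasurable (mollify j G) μ :=
  (contDiff_mollify hG j).continuous.aestronglyMeasurable

/-- Mollification is a contraction of `L²`. -/
lemma eLpNorm_mollify_le {G : Space d → V} (hG : M.InLp G 2) (j : ℕ) :
    eLpNorm (mollify j G) 2 (M.vol d) ≤ eLpNorm G 2 (M.vol d) := by
  have hGm := aestronglyMeasurable_volume hG.1 hG.2.1
  have hpt : ∀ x, ‖mollify j G x‖ₑ ^ (2 : ℝ) ≤ ∫⁻ t, ‖G (x - t)‖ₑ ^ (2 : ℝ) ∂kernelMeasure d j := by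
    intro x
    have hm : AEStronglyMeasurable (fun t => G (x - t)) (kernelMeasure d j) :=
      (hGm.comp_measurePreserving (Measure.measurePreserving_sub_left volume x)).mono_ac
        (kernelMeasure_absolutelyContinuous j)
    have hm' : AEMeasurable (fun t => ‖G (x - t)‖ₑ) volume :=
      (hGm.comp_measurePreserving (Measure.measurePreserving_sub_left volume x)).enorm
    -- Jensen's inequality, in the form `L¹ ≤ L²` for the probability measure `kernelMeasure`.
    have h1 : ‖mollify j G x‖ₑ ≤ eLpNorm (fun t => G (x - t)) 1 (kernelMeasure d j) := by
      refine (enorm_integral_le_lintegral_enorm _).trans (le_of_eq ?_)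
      rw [eLpNorm_one_eq_lintegral_enorm, kernelMeasure,
        lintegral_withDensity_eq_lintegral_mul₀ 
          ((contDiff_kernel (d := d) j).continuous.measurable.ennreal_ofReal.aemeasurable)
          (g := fun t => ‖G (x - t)‖ₑ) hm']
      congr 1; ext t
      rw [enorm_smul, Pi.mul_apply, Real.enorm_of_nonneg (kernel_nonneg j t)]
    have h2 := h1.trans (eLpNorm_le_eLpNorm_of_exponent_le (q := 2) (by norm_num) hm)
    rw [eLpNorm_eq_lintegral_rpow_enorm_toReal (by simp) (by simp), one_div] at h2
    simp only [ENNReal.toReal_ofNat] at h2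
    exact (ENNReal.le_rpow_inv_iff (by norm_num)).1 h2
  rw [eLpNorm_eq_lintegral_rpow_enorm_toReal (by simp) (by simp),
    eLpNorm_eq_lintegral_rpow_enorm_toReal (by simp) (by simp)]
  simp only [ENNReal.toReal_ofNat]
  gcongr ?_ ^ _
  refine (lintegral_mono hpt).trans ?_
  rw [lintegral_lintegral_swap]
  · refine le_of_eq ?_
    have h3 : ∀ t, ∫⁻ x, ‖G (x - t)‖ₑ ^ (2 : ℝ) ∂M.vol d = ∫⁻ x, ‖G x‖ₑ ^ (2 : ℝ) ∂M.vol d := by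
      intro t
      simp only [sub_eq_add_neg]
      exact lintegral_add_right (hG.1.comp fun y => ‖y‖ₑ ^ (2 : ℝ)) (-t)
    simp only [h3, lintegral_const, measure_univ, mul_one]
  · exact (aestronglyMeasurable_comp_sub hG.1 hG.2.1
      (kernelMeasure_absolutelyContinuous j)).enorm.pow_const _

lemma InLp.mollify {G : Space d → V} (hG : M.InLp G 2) (j : ℕ) : M.InLp (mollify j G) 2 :=
  ⟨hG.1.mollify j, aestronglyMeasurable_mollify (hG.locallyIntegrable (by norm_num)) j,
    (eLpNorm_mollify_le hG j).trans_lt hG.2.2⟩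

/-- Mollifications converge strongly in `L²`. -/
lemma tendsto_eLpNorm_mollify_sub [CompleteSpace V] {G : Space d → V} (hG : M.InLp G 2) :
    Tendsto (fun j => eLpNorm (fun x => FlatDomain.mollify j G x - G x) 2 (M.vol d)) atTop
      (𝓝 0) := by
  have h0 := tendsto_integral_inner_mollify (p := 2) (q := 2) (by norm_num) hG hG
  set x : Lp V 2 (M.vol d) := hG.2.toLp G
  set y : ℕ → Lp V 2 (M.vol d) := fun j => (hG.mollify j).2.toLp (FlatDomain.mollify j G)
  have h1 : ∀ j, ∫ x, inner ℝ (G x) (FlatDomain.mollify j G x) ∂M.vol d = inner ℝ x (y j) := by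
    intro j
    rw [L2.inner_def]
    refine integral_congr_ae ?_
    filter_upwards [hG.2.coeFn_toLp, (hG.mollify j).2.coeFn_toLp] with z h1 h2
    rw [h1, h2]
  have h2 : ∫ x, inner ℝ (G x) (G x) ∂M.vol d = ‖x‖ ^ 2 := by
    rw [← real_inner_self_eq_norm_sq, L2.inner_def]
    refine integral_congr_ae ?_
    filter_upwards [hG.2.coeFn_toLp] with z h1
    rw [h1]
  simp only [h1, h2] at h0
  have hle : ∀ j, ‖y j‖ ≤ ‖x‖ := fun j => by
    simp only [x, y, Lp.norm_toLp]
    exact ENNReal.toReal_mono hG.2.2.ne (eLpNorm_mollify_le hG j)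
  -- Since `‖y j‖ ≤ ‖x‖`, one has `‖y j - x‖² ≤ 2‖x‖² - 2⟪x, y j⟫`, which tends to zero by weak
  -- convergence.
  have h3 : Tendsto (fun j => ‖y j - x‖ ^ 2) atTop (𝓝 0) := by
    have hb : Tendsto (fun j => 2 * ‖x‖ ^ 2 - 2 * inner ℝ x (y j)) atTop (𝓝 0) := by
      have := (h0.const_mul 2).const_sub (2 * ‖x‖ ^ 2)
      simpa using this
    refine squeeze_zero (fun _ => by positivity) (fun j => ?_) hb
    rw [norm_sub_sq_real, real_inner_comm]
    have := pow_le_pow_left₀ (norm_nonneg _) (hle j) 2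
    linarith
  have h4 : Tendsto y atTop (𝓝 x) := by
    rw [tendsto_iff_norm_sub_tendsto_zero]
    have := h3.sqrt
    simpa using this
  rw [Lp.tendsto_Lp_iff_tendsto_eLpNorm'] at h4
  refine h4.congr fun j => eLpNorm_congr_ae ?_
  filter_upwards [hG.2.coeFn_toLp, (hG.mollify j).2.coeFn_toLp] with z h1 h2
  simp only [Pi.sub_apply, x, y, h1, h2]

end FlatDomain

/-! ### Test functions and their density in `H¹` -/

namespace FlatDomain
open scoped Pointwise
variable {d : ℕ} {M : FlatDomain} {F : Type*} [NormedAddCommGroup F]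

lemma norm_gradient (φ : Space d → ℝ) (x : Space d) : ‖gradient φ x‖ = ‖fderiv ℝ φ x‖ := by
  rw [gradient, LinearIsometryEquiv.norm_map]

lemma continuous_gradient {φ : Space d → ℝ} (hφ : ContDiff ℝ ∞ φ) : Continuous (gradient φ) :=
  (InnerProductSpace.toDual ℝ (Space d)).symm.continuous.comp (hφ.continuous_fderiv (by simp))

lemma gradient_mul {φ ψ : Space d → ℝ} {x : Space d} (hφ : DifferentiableAt ℝ φ x)
    (hψ : DifferentiableAt ℝ ψ x) :
    gradient (fun y => φ y * ψ y) x = φ x • gradient ψ x + ψ x • gradient φ x := by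
  ext i
  simp only [gradient_apply, PiLp.add_apply, PiLp.smul_apply]
  rw [fderiv_fun_mul hφ hψ]
  simp

lemma gradient_sub {φ ψ : Space d → ℝ} {x : Space d} (hφ : DifferentiableAt ℝ φ x)
    (hψ : DifferentiableAt ℝ ψ x) :
    gradient (fun y => φ y - ψ y) x = gradient φ x - gradient ψ x := by
  ext i
  simp only [gradient_apply, PiLp.sub_apply]
  rw [fderiv_fun_sub hφ hψ]
  simp

lemma gradient_comp {T : ℝ → ℝ} {φ : Space d → ℝ} {x : Space d} (hT : DifferentiableAt ℝ T (φ x))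
    (hφ : DifferentiableAt ℝ φ x) :
    gradient (fun y => T (φ y)) x = deriv T (φ x) • gradient φ x := by
  ext i
  simp only [gradient_apply, PiLp.smul_apply]
  rw [show (fun y => T (φ y)) = T ∘ φ from rfl, fderiv_comp x hT hφ]
  simp [mul_comm]

lemma isFunction_gradient {φ : Space d → ℝ} (hφ : M.IsFunction φ) :
    M.IsFunction (gradient φ) := by
  rw [isFunction_iff] at *
  intro g x
  ext i
  have h : (fun y => φ ((g : Space d) + y)) = φ := funext fun y => hφ g y
  rw [gradient_apply, gradient_apply, AddSubgroup.vadd_def, vadd_eq_add,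
    ← fderiv_comp_add_left, h]

lemma inLp_of_continuous_of_test {h : Space d → F} (hc : Continuous h) (hM : M.IsFunction h)
    (hs : M = euclidean → HasCompactSupport h) (q : ℝ≥0∞) : M.InLp h q := by
  refine ⟨hM, ?_⟩
  cases M
  · exact hc.memLp_of_hasCompactSupport (hs rfl)
  · obtain ⟨C, hC⟩ := (isCompact_closedBall (0 : Space d) √d).exists_bound_of_continuousOn
      hc.continuousOn
    refine MemLp.of_bound hc.aestronglyMeasurable C ?_
    filter_upwards [ae_restrict_mem (measurableSet_unitCell d)] with x hx
    exact hC x (mem_closedBall_zero_iff.2 (norm_le_of_mem_unitCell hx))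

lemma IsTest.hasCompactSupport {φ : Space d → ℝ} (hφ : M.IsTest φ) (h : M = euclidean) :
    HasCompactSupport φ := by
  subst h; exact hφ.2.2

lemma isTest_iff {φ : Space d → ℝ} : M.IsTest φ ↔
    ContDiff ℝ ∞ φ ∧ M.IsFunction φ ∧ (M = euclidean → HasCompactSupport φ) := by
  cases M <;> simp [IsTest]

lemma IsTest.differentiable {φ : Space d → ℝ} (hφ : M.IsTest φ) : Differentiable ℝ φ :=
  hφ.1.differentiable (by simp)

lemma IsTest.inLp {φ : Space d → ℝ} (hφ : M.IsTest φ) (q : ℝ≥0∞) : M.InLp φ q :=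
  inLp_of_continuous_of_test hφ.1.continuous hφ.2.1 hφ.hasCompactSupport q

lemma IsTest.hasCompactSupport_gradient {φ : Space d → ℝ} (hφ : M.IsTest φ)
    (h : M = euclidean) : HasCompactSupport (gradient φ) :=
  ((hφ.hasCompactSupport h).fderiv ℝ).comp_left
      (g := (InnerProductSpace.toDual ℝ (Space d)).symm) (map_zero _)

lemma IsTest.inLp_gradient {φ : Space d → ℝ} (hφ : M.IsTest φ) (q : ℝ≥0∞) :
    M.InLp (gradient φ) q :=
  inLp_of_continuous_of_test (continuous_gradient hφ.1) (isFunction_gradient hφ.2.1)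
    hφ.hasCompactSupport_gradient q

lemma IsTest.mul {φ ψ : Space d → ℝ} (hφ : M.IsTest φ) (hψ : ContDiff ℝ ∞ ψ)
    (hψM : M.IsFunction ψ) : M.IsTest (fun x => φ x * ψ x) := by
  rw [isTest_iff] at *
  exact ⟨hφ.1.mul hψ, hφ.2.1.comp₂ hψM _, fun h => (hφ.2.2 h).mul_right⟩

lemma IsTest.sub {φ ψ : Space d → ℝ} (hφ : M.IsTest φ) (hψ : M.IsTest ψ) :
    M.IsTest (fun x => φ x - ψ x) := by
  rw [isTest_iff] at *
  exact ⟨hφ.1.sub hψ.1, hφ.2.1.comp₂ hψ.2.1 _, fun h => (hφ.2.2 h).sub (hψ.2.2 h)⟩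

lemma IsTest.comp {φ : Space d → ℝ} (hφ : M.IsTest φ) {T : ℝ → ℝ} (hT : ContDiff ℝ ∞ T)
    (h0 : T 0 = 0) : M.IsTest (fun x => T (φ x)) := by
  rw [isTest_iff] at *
  exact ⟨hT.comp hφ.1, hφ.2.1.comp _, fun h => (hφ.2.2 h).comp_left h0⟩

/-- Dilates of one bump on `ℝ^d`; the constant `1` on the torus, where no cutoff is needed. The
decay of the gradient removes the commutator term in the density theorem. -/
lemma exists_cutoff (M : FlatDomain) (d : ℕ) :
    ∃ (χ : ℕ → Space d → ℝ) (C : ℝ), ∀ j, M.IsTest (χ j) ∧ (∀ x, ‖χ j x‖ ≤ 1) ∧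
      (∀ x, ‖x‖ ≤ j → χ j x = 1) ∧ ∀ x, ‖gradient (χ j) x‖ ≤ C / (j + 1) := by
  cases M
  · let b : ContDiffBump (0 : Space d) := ⟨1, 2, one_pos, one_lt_two⟩
    have hb : ContDiff ℝ ∞ b := b.contDiff
    obtain ⟨C, hC⟩ := (hb.continuous_fderiv (by simp)).bounded_above_of_compact_support
      (b.hasCompactSupport.fderiv ℝ)
    refine ⟨fun j x => b ((j + 1 : ℝ)⁻¹ • x), C, fun j => ⟨⟨?_, trivial, ?_⟩, fun x => ?_,
      fun x hx => ?_, fun x => ?_⟩⟩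
    · exact hb.comp (contDiff_const_smul _)
    · exact b.hasCompactSupport.comp_smul (by positivity)
    · rw [Real.norm_of_nonneg b.nonneg]; exact b.le_one
    · apply b.one_of_mem_closedBall
      rw [mem_closedBall_zero_iff, norm_smul, norm_inv, Real.norm_of_nonneg (by positivity),
        inv_mul_le_iff₀ (by positivity)]
      simp [b]; linarith
    · rw [norm_gradient, fderiv_comp_smul, norm_smul, norm_inv,
        Real.norm_of_nonneg (by positivity), div_eq_inv_mul]
      exact mul_le_mul_of_nonneg_left (hC _) (by positivity)
  · refine ⟨fun _ _ => 1, 0, fun j => ⟨⟨contDiff_const, IsFunction.const _, trivial⟩, ?_⟩⟩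
    refine ⟨by simp, by simp, fun x => ?_⟩
    rw [norm_gradient]
    simp

lemma tendsto_eLpNorm_two_of_dominated {α : Type*} {m : MeasurableSpace α} {μ : Measure α}
    {f : ℕ → α → F} {B : α → ℝ} (hf : ∀ j, AEStronglyMeasurable (f j) μ) (hB : MemLp B 2 μ)
    (hfB : ∀ j, ∀ᵐ x ∂μ, ‖f j x‖ ≤ ‖B x‖)
    (h0 : ∀ᵐ x ∂μ, Tendsto (fun j => f j x) atTop (𝓝 0)) :
    Tendsto (fun j => eLpNorm (f j) 2 μ) atTop (𝓝 0) := by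
  have h : Tendsto (fun j => ∫⁻ x, ‖f j x‖ₑ ^ (2 : ℝ) ∂μ) atTop (𝓝 (∫⁻ _, 0 ∂μ)) := by
    refine tendsto_lintegral_of_dominated_convergence' (fun x => ‖B x‖ₑ ^ (2 : ℝ))
      (fun j => (hf j).enorm.pow_const _) (fun j => ?_) ?_ ?_
    · filter_upwards [hfB j] with x hx
      gcongr
      exact enorm_le_iff_norm_le.2 hx
    · have := (eLpNorm_lt_top_iff_lintegral_rpow_enorm_lt_top (p := 2) (by simp) (by simp)).1 hB.2
      simpa using this.ne
    · filter_upwards [h0] with x hx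
      have h1 := hx.enorm
      have h2 := ((ENNReal.continuous_rpow_const (y := 2)).tendsto _).comp h1
      simpa [Function.comp_def] using h2
  have h2 := ((ENNReal.continuous_rpow_const (y := 1 / 2)).tendsto _).comp h
  simp only [lintegral_const, zero_mul, Function.comp_def] at h2
  rw [ENNReal.zero_rpow_of_pos (by norm_num)] at h2
  refine h2.congr fun j => ?_
  rw [eLpNorm_eq_lintegral_rpow_enorm_toReal (by simp) (by simp)]
  simp

lemma tendsto_eLpNorm_cutoff_sub [NormedSpace ℝ F] {G : Space d → F} {μ : Measure (Space d)}
    (hG : MemLp G 2 μ)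
    {χ : ℕ → Space d → ℝ} (hχm : ∀ j, Continuous (χ j)) (hχ : ∀ j x, ‖χ j x‖ ≤ 1)
    (h1 : ∀ (j : ℕ) x, ‖x‖ ≤ j → χ j x = 1) :
    Tendsto (fun j => eLpNorm (fun x => χ j x • G x - G x) 2 μ) atTop (𝓝 0) := by
  refine tendsto_eLpNorm_two_of_dominated (B := fun x => 2 * ‖G x‖)
    (fun j => ((hχm j).aestronglyMeasurable.smul hG.1).sub hG.1) (hG.norm.const_mul 2)
    (fun j => Eventually.of_forall fun x => ?_) (Eventually.of_forall fun x => ?_)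
  · rw [Real.norm_of_nonneg (by positivity)]
    refine (norm_sub_le _ _).trans ?_
    rw [norm_smul]
    nlinarith [hχ j x, norm_nonneg (G x)]
  · refine tendsto_const_nhds.congr' ?_
    filter_upwards [eventually_ge_atTop ⌈‖x‖⌉₊] with j hj
    rw [h1 j x ((Nat.le_ceil _).trans (by exact_mod_cast hj))]
    simp

/-- Test functions are dense in `H¹`. -/
theorem exists_seq_isTest {u : Space d → ℝ} {Du : Space d → Space d} (hu : M.InLp u 2)
    (hDu : M.InLp Du 2) (h : M.HasWeakGradient u Du) :
    ∃ φ : ℕ → Space d → ℝ, (∀ j, M.IsTest (φ j)) ∧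
      Tendsto (fun j => eLpNorm (fun x => φ j x - u x) 2 (M.vol d)) atTop (𝓝 0) ∧
      Tendsto (fun j => eLpNorm (fun x => gradient (φ j) x - Du x) 2 (M.vol d)) atTop (𝓝 0) ∧
      ∀ᵐ x ∂M.vol d, Tendsto (fun j => φ j x) atTop (𝓝 (u x)) := by
  obtain ⟨χ, C, hχ⟩ := exists_cutoff M d
  have hul := hu.locallyIntegrable (by norm_num)
  have hDul := hDu.locallyIntegrable (by norm_num)
  have hχc : ∀ j, Continuous (χ j) := fun j => (hχ j).1.1.continuous
  set φ : ℕ → Space d → ℝ := fun j x => χ j x * mollify j u x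
  have hφ : ∀ j, M.IsTest (φ j) := fun j => (hχ j).1.mul (contDiff_mollify hul j) (hu.1.mollify j)
  have hm : ∀ j, AEStronglyMeasurable (φ j) (M.vol d) := fun j => (hφ j).1.continuous.aestronglyMeasurable
  have h1 : Tendsto (fun j => eLpNorm (fun x => φ j x - u x) 2 (M.vol d)) atTop (𝓝 0) := by
    have hb := (tendsto_eLpNorm_mollify_sub hu).add (tendsto_eLpNorm_cutoff_sub hu.2 hχc
      (fun j => (hχ j).2.1) fun j => (hχ j).2.2.1)
    rw [add_zero] at hb
    refine tendsto_of_tendsto_of_tendsto_of_le_of_le tendsto_const_nhds hb (fun _ => zero_le)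
      fun j => ?_
    have he : (fun x => φ j x - u x) = (fun x => χ j x • (mollify j u x - u x)) +
        fun x => χ j x • u x - u x := by
      ext x; simp [φ]; ring
    rw [he]
    refine (eLpNorm_add_le ((hχc j).aestronglyMeasurable.smul
      ((aestronglyMeasurable_mollify hul j).sub hu.2.1))
      (((hχc j).aestronglyMeasurable.smul hu.2.1).sub hu.2.1) (by norm_num)).trans ?_
    refine add_le_add_left (eLpNorm_mono fun x => ?_) _
    change ‖χ j x • (mollify j u x - u x)‖ ≤ _
    rw [norm_smul]
    exact mul_le_of_le_one_left (norm_nonneg _) ((hχ j).2.1 x)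
  have h2 : Tendsto (fun j => eLpNorm (fun x => gradient (φ j) x - Du x) 2 (M.vol d))
      atTop (𝓝 0) := by
    have hC : Tendsto (fun j : ℕ => ENNReal.ofReal (C / (j + 1)) * eLpNorm u 2 (M.vol d)) atTop
        (𝓝 0) := by
      have h3 : Tendsto (fun j : ℕ => C / ((j : ℝ) + 1)) atTop (𝓝 0) := by
        simpa [div_eq_mul_inv] using (tendsto_one_div_add_atTop_nhds_zero_nat (𝕜 := ℝ)).const_mul C
      have := ENNReal.Tendsto.mul_const (ENNReal.tendsto_ofReal h3) (Or.inr hu.2.2.ne)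
      simpa using this
    have hb := ((tendsto_eLpNorm_mollify_sub hDu).add (tendsto_eLpNorm_cutoff_sub hDu.2 hχc
      (fun j => (hχ j).2.1) fun j => (hχ j).2.2.1)).add hC
    rw [add_zero, add_zero] at hb
    refine tendsto_of_tendsto_of_tendsto_of_le_of_le tendsto_const_nhds hb (fun _ => zero_le)
      fun j => ?_
    -- Three errors: mollification, cutoff, and the gradient falling on the cutoff. The last is
    -- bounded by `C / (j + 1)` times `‖u‖`.
    have he : (fun x => gradient (φ j) x - Du x) =
        ((fun x => χ j x • (mollify j Du x - Du x)) + fun x => χ j x • Du x - Du x) +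
          fun x => mollify j u x • gradient (χ j) x := by
      ext1 x
      simp only [φ, Pi.add_apply]
      rw [gradient_mul (hχ j).1.differentiable.differentiableAt
        ((contDiff_mollify hul j).differentiable (by simp)).differentiableAt,
        gradient_mollify h hul hDul, smul_sub]
      abel
    have m1 : AEStronglyMeasurable (fun x => χ j x • (mollify j Du x - Du x)) (M.vol d) :=
      (hχc j).aestronglyMeasurable.smul ((aestronglyMeasurable_mollify hDul j).sub hDu.2.1)
    have m2 : AEStronglyMeasurable (fun x => χ j x • Du x - Du x) (M.vol d) :=
      ((hχc j).aestronglyMeasurable.smul hDu.2.1).sub hDu.2.1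
    have m3 : AEStronglyMeasurable (fun x => mollify j u x • gradient (χ j) x) (M.vol d) :=
      (aestronglyMeasurable_mollify hul j).smul
        (continuous_gradient (hχ j).1.1).aestronglyMeasurable
    rw [he]
    refine (eLpNorm_add_le (m1.add m2) m3 (by norm_num)).trans (add_le_add
      ((eLpNorm_add_le m1 m2 (by norm_num)).trans ?_) ?_)
    · refine add_le_add_left (eLpNorm_mono fun x => ?_) _
      rw [norm_smul]
      exact mul_le_of_le_one_left (norm_nonneg _) ((hχ j).2.1 x)
    · refine (eLpNorm_le_mul_eLpNorm_of_ae_le_mul (g := mollify j u)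
        (Eventually.of_forall fun x => ?_) 2).trans
        (mul_le_mul_right (eLpNorm_mollify_le hu j) _)
      rw [norm_smul, mul_comm]
      exact mul_le_mul_of_nonneg_right ((hχ j).2.2.2 x) (norm_nonneg _)
  -- Convergence almost everywhere holds along a subsequence, and the norm convergences survive it.
  obtain ⟨s, hs, hae⟩ := (tendstoInMeasure_of_tendsto_eLpNorm (p := 2) (by norm_num) hm hu.2.1
    h1).exists_seq_tendsto_ae
  exact ⟨fun j => φ (s j), fun j => hφ _, h1.comp hs.tendsto_atTop, h2.comp hs.tendsto_atTop, hae⟩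

end FlatDomain

/-! ### Sobolev inequality and form boundedness of the drift -/

namespace FlatDomain
open scoped Pointwise
variable {d : ℕ} {M : FlatDomain} {F : Type*} [NormedAddCommGroup F]

lemma eLpNorm_two_sq {α : Type*} {m : MeasurableSpace α} {μ : Measure α} (f : α → F) :
    eLpNorm f 2 μ ^ 2 = ∫⁻ x, ‖f x‖ₑ ^ 2 ∂μ := by
  have := eLpNorm_nnreal_pow_eq_lintegral (μ := μ) (f := f) (p := 2) (by simp)
  simpa using this

/-- The exponents admissible for the Sobolev inequality. -/
def IsSobolevExponent (d : ℕ) (s : NNReal) : Prop := (d : NNReal) < s ∨ 3 ≤ d ∧ s = d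

/-- Hölder forces `1/q = 1/2 - 1/s`, and the Sobolev embedding of `W^{1,p}` needs `p < d` and `1/p -
1/d ≤ 1/q`. For `d ≥ 3` the choice `p = 2` works because `s ≥ d`. For `d = 2` one must take `p < 2`,
and `1/p = 1 - 1/s` gives equality. -/
lemma IsSobolevExponent.exists_exponents (hd : 2 ≤ d) {s : NNReal} (hs : IsSobolevExponent d s) :
    ∃ q p : NNReal, ENNReal.HolderTriple s q 2 ∧ 1 ≤ p ∧ p ≤ 2 ∧ (p : ℝ) < d ∧
      (p : ℝ)⁻¹ - (d : ℝ)⁻¹ ≤ (q : ℝ)⁻¹ := by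
  have hd' : (2 : ℝ) ≤ d := by exact_mod_cast hd
  have hs2 : (2 : ℝ) < s := by
    rcases hs with h | ⟨h, rfl⟩
    · have : (d : ℝ) < s := by exact_mod_cast h
      linarith
    · have : (3 : ℝ) ≤ d := by exact_mod_cast h
      simp; linarith
  have hds : (d : ℝ) ≤ s := by
    rcases hs with h | ⟨h, rfl⟩
    · exact_mod_cast h.le
    · simp
  have hspos : (0 : ℝ) < s := by linarith
  have hsinv : (s : ℝ)⁻¹ < 2⁻¹ := (inv_lt_inv₀ hspos two_pos).2 hs2
  set q : NNReal := (2⁻¹ - s⁻¹)⁻¹ with hq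
  have hsn : s⁻¹ < 2⁻¹ := by rw [← NNReal.coe_lt_coe]; simpa using hsinv
  have hqr : (q : ℝ)⁻¹ = 2⁻¹ - (s : ℝ)⁻¹ := by
    rw [hq, NNReal.coe_inv, inv_inv, NNReal.coe_sub hsn.le]; simp
  have hqn : q⁻¹ = 2⁻¹ - s⁻¹ := by rw [hq, inv_inv]
  have hq0 : q ≠ 0 := by
    rw [hq]; exact inv_ne_zero (tsub_pos_of_lt hsn).ne'
  have hs0 : s ≠ 0 := fun h => by simp [h] at hspos
  refine ⟨q, ?_⟩
  rw [exists_and_left]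
  refine ⟨⟨?_⟩, ?_⟩
  · rw [← ENNReal.coe_inv hs0, ← ENNReal.coe_inv hq0, hqn, ← ENNReal.coe_add,
      add_tsub_cancel_of_le hsn.le]
    simp
  · clear_value q
    rw [hqr]
    by_cases h3 : 3 ≤ d
    · refine ⟨2, one_le_two, le_rfl, ?_, ?_⟩
      · have : (3 : ℝ) ≤ d := by exact_mod_cast h3
        simp; linarith
      · have := inv_anti₀ (by linarith : (0 : ℝ) < d) hds
        simp; linarith
    · obtain rfl : d = 2 := by omega
      have hs1 : s⁻¹ ≤ 1 := hsn.le.trans (by rw [← NNReal.coe_le_coe]; norm_num)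
      have hpr : (((1 - s⁻¹)⁻¹ : NNReal) : ℝ)⁻¹ = 1 - (s : ℝ)⁻¹ := by
        rw [NNReal.coe_inv, inv_inv, NNReal.coe_sub hs1]; simp
      have hp0 : (0 : ℝ) < ((1 - s⁻¹)⁻¹ : NNReal) := by
        rw [← inv_pos, hpr]; linarith
      have hlt : (((1 - s⁻¹)⁻¹ : NNReal) : ℝ) < 2 := by
        rw [← inv_lt_inv₀ two_pos hp0, hpr]; linarith
      refine ⟨(1 - s⁻¹)⁻¹, ?_, ?_, by exact_mod_cast hlt, ?_⟩
      · rw [← NNReal.coe_le_coe, ← inv_le_inv₀ hp0 (by norm_num), hpr]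
        simp
      · rw [← NNReal.coe_le_coe]; exact hlt.le
      · rw [hpr]; norm_num; linarith

lemma eLpNorm_fderiv_restrict {Q : Set (Space d)} {v : Space d → ℝ} (hvQ : v.support ⊆ Q)
    (hQ : IsClosed Q) (r : ℝ≥0∞) :
    eLpNorm (fderiv ℝ v) r (volume.restrict Q) = eLpNorm (fderiv ℝ v) r volume := by
  have hsub : (fderiv ℝ v).support ⊆ Q :=
    (support_fderiv_subset ℝ).trans (closure_minimal hvQ hQ)
  rw [← eLpNorm_norm, ← eLpNorm_norm (fderiv ℝ v)]
  refine eLpNorm_restrict_eq_of_support_subset (f := fun x => ‖fderiv ℝ v x‖) ?_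
  intro x hx
  exact hsub (by simpa using hx)

/-- The gradient exponent is raised from `p` to `2` by Hölder on the bounded set `Q`, at the price
of a power of its volume. -/
lemma exists_eLpNorm_le_fderiv (hd : 2 ≤ d) {s : NNReal} (hs : IsSobolevExponent d s) :
    ∃ q : NNReal, ENNReal.HolderTriple s q 2 ∧ ∀ Q : Set (Space d), Bornology.IsBounded Q →
      IsClosed Q → ∃ C : NNReal, ∀ v : Space d → ℝ, ContDiff ℝ 1 v → v.support ⊆ Q →
        eLpNorm v q volume ≤ C * eLpNorm (fderiv ℝ v) 2 volume := by
  obtain ⟨q, p, hq, hp1, hp2, hpd, hpq⟩ := hs.exists_exponents hd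
  refine ⟨q, hq, ?_⟩
  intro Q hQ hQc
  refine ⟨eLpNormLESNormFDerivOfLeConst ℝ volume Q p q *
    ((volume Q) ^ (1 / (p : ℝ) - 1 / 2)).toNNReal, fun v hv hvQ => ?_⟩
  have h1 := eLpNorm_le_eLpNorm_fderiv_of_le volume hv hvQ hp1 (by rw [← NNReal.coe_lt_coe]; simpa using hpd)
    (by simpa using hpq) hQ
  refine h1.trans ?_
  rw [ENNReal.coe_mul, mul_assoc]
  refine mul_le_mul_right ?_ _
  have hr := eLpNorm_fderiv_restrict hvQ hQc
  rw [← hr p]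
  have h2 := eLpNorm_le_eLpNorm_mul_rpow_measure_univ (p := p) (q := 2) (μ := volume.restrict Q)
    (by exact_mod_cast hp2) (f := fderiv ℝ v)
    (hv.continuous_fderiv one_ne_zero).aestronglyMeasurable
  refine h2.trans ?_
  rw [mul_comm, Measure.restrict_apply_univ, hr,
    ENNReal.coe_toNNReal]
  · simp
  · refine (ENNReal.rpow_lt_top_of_nonneg ?_ hQ.measure_lt_top.ne).ne
    have hp0 : (0 : ℝ) < p := by have : (1 : ℝ) ≤ p := by exact_mod_cast hp1
                                 linarith
    rw [sub_nonneg]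
    exact one_div_le_one_div_of_le hp0 (by exact_mod_cast hp2)

/-- Localisation by a bump `χ` equal to `1` on the cell: Hölder and Sobolev are applied to `χ v`,
and the derivative of `χ` produces the zeroth order term. -/
lemma exists_setLIntegral_unitCell_le (hd : 2 ≤ d) {s : NNReal} (hs : IsSobolevExponent d s) :
    ∃ (Q : Set (Space d)) (C : NNReal), Bornology.IsBounded Q ∧
      ∀ (b : Space d → Space d) (v : Space d → ℝ),
        AEStronglyMeasurable b volume → ContDiff ℝ 1 v →
        ∫⁻ x in unitCell d, ‖v x • b x‖ₑ ^ 2 ≤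
          C * eLpNorm b s volume ^ 2 * ∫⁻ x in Q, (‖gradient v x‖ₑ ^ 2 + ‖v x‖ₑ ^ 2) := by
  obtain ⟨q, hq, hQ⟩ := exists_eLpNorm_le_fderiv hd hs
  let χ : ContDiffBump (0 : Space d) := ⟨√d + 1, √d + 2, by positivity, by linarith⟩
  have hχ : ContDiff ℝ 1 χ := χ.contDiff
  obtain ⟨C₁, hC₁⟩ := (hχ.continuous_fderiv one_ne_zero).bounded_above_of_compact_support
    (χ.hasCompactSupport.fderiv ℝ)
  obtain ⟨C, hC⟩ := hQ (Metric.closedBall 0 (√d + 2)) Metric.isBounded_closedBall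
    Metric.isClosed_closedBall
  have hC₁0 : 0 ≤ C₁ := (norm_nonneg _).trans (hC₁ 0)
  refine ⟨Metric.closedBall 0 (√d + 2), C ^ 2 * (2 * (1 + C₁.toNNReal ^ 2)),
    Metric.isBounded_closedBall, fun b v hb hv => ?_⟩
  set w : Space d → ℝ := fun x => χ x * v x
  have hw : ContDiff ℝ 1 w := hχ.mul hv
  have hwQ : w.support ⊆ Metric.closedBall 0 (√d + 2) := by
    refine (Function.support_mul_subset_left _ _).trans ?_
    rw [χ.support_eq]
    exact Metric.ball_subset_closedBall
  have h1 : ∫⁻ x in unitCell d, ‖v x • b x‖ₑ ^ 2 ≤ ∫⁻ x, ‖w x • b x‖ₑ ^ 2 := by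
    refine le_trans (le_of_eq ?_) (setLIntegral_le_lintegral (unitCell d) _)
    refine setLIntegral_congr_fun (measurableSet_unitCell d) fun x hx => ?_
    have : χ x = 1 := χ.one_of_mem_closedBall (mem_closedBall_zero_iff.2
      ((norm_le_of_mem_unitCell hx).trans (by simp [χ])))
    simp [w, this]
  have h2 : eLpNorm (fun x => w x • b x) 2 volume ≤ eLpNorm w q volume * eLpNorm b s volume :=
    have := hq.symm
    eLpNorm_smul_le_mul_eLpNorm (r := 2) (p := q) (q := s) (f := b) (φ := w) hb
      hw.continuous.aestronglyMeasurable
  have h3 : eLpNorm (fderiv ℝ w) 2 volume ^ 2 ≤ (2 * (1 + C₁.toNNReal ^ 2) : NNReal) *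
      ∫⁻ x in Metric.closedBall 0 (√d + 2), (‖gradient v x‖ₑ ^ 2 + ‖v x‖ₑ ^ 2) := by
    rw [← eLpNorm_fderiv_restrict hwQ Metric.isClosed_closedBall, eLpNorm_two_sq,
      ← lintegral_const_mul' _ _ ENNReal.coe_ne_top]
    refine lintegral_mono fun x => ?_
    -- From `(a + C₁ c)² ≤ 2a² + 2C₁²c² ≤ 2(1 + C₁²)(a² + c²)`.
    have h4 : ‖fderiv ℝ w x‖ ^ 2 ≤ 2 * (1 + C₁ ^ 2) * (‖gradient v x‖ ^ 2 + ‖v x‖ ^ 2) := by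
      have h5 : ‖fderiv ℝ w x‖ ≤ ‖gradient v x‖ + C₁ * ‖v x‖ := by
        simp only [w]
        rw [fderiv_fun_mul (hχ.differentiable one_ne_zero).differentiableAt
          (hv.differentiable one_ne_zero).differentiableAt, norm_gradient]
        refine (norm_add_le _ _).trans ?_
        rw [norm_smul, norm_smul, mul_comm C₁]
        refine add_le_add ?_ (mul_le_mul_of_nonneg_left (hC₁ x) (norm_nonneg _))
        refine mul_le_of_le_one_left (norm_nonneg _) ?_
        rw [Real.norm_of_nonneg χ.nonneg]; exact χ.le_one
      calc ‖fderiv ℝ w x‖ ^ 2 ≤ (‖gradient v x‖ + C₁ * ‖v x‖) ^ 2 :=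
            pow_le_pow_left₀ (norm_nonneg _) h5 2
        _ ≤ _ := by nlinarith [sq_nonneg (‖gradient v x‖ - C₁ * ‖v x‖), sq_nonneg (C₁ * ‖gradient v x‖), sq_nonneg ‖v x‖]
    have h6 : ‖fderiv ℝ w x‖₊ ^ 2 ≤ 2 * (1 + C₁.toNNReal ^ 2) *
        (‖gradient v x‖₊ ^ 2 + ‖v x‖₊ ^ 2) := by
      rw [← NNReal.coe_le_coe]; simpa [hC₁0] using h4
    simp only [enorm_eq_nnnorm]
    exact_mod_cast h6
  calc ∫⁻ x in unitCell d, ‖v x • b x‖ₑ ^ 2 ≤ eLpNorm (fun x => w x • b x) 2 volume ^ 2 := by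
        rw [eLpNorm_two_sq]; exact h1
    _ ≤ (C * eLpNorm (fderiv ℝ w) 2 volume * eLpNorm b s volume) ^ 2 := by
        exact pow_le_pow_left' (h2.trans (mul_le_mul_left (hC w hw hwQ) _)) 2
    _ = C ^ 2 * eLpNorm b s volume ^ 2 * eLpNorm (fderiv ℝ w) 2 volume ^ 2 := by ring
    _ ≤ _ := by
        refine (mul_le_mul_right h3 _).trans (le_of_eq ?_)
        push_cast
        ring

/-- On `ℝ^d` the local inequality is summed over all lattice translates; each uses the full norm of
`b`, and the sets `Q` overlap boundedly. On the torus a single cell suffices, with `b` cut off to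
it. -/
lemma exists_lintegral_smul_le (hd : 2 ≤ d) {s : NNReal} (hs : IsSobolevExponent d s)
    (M : FlatDomain) :
    ∃ C : NNReal, ∀ (b : Space d → Space d) (v : Space d → ℝ), M.InLp b s → M.IsTest v →
      ∫⁻ x, ‖v x • b x‖ₑ ^ 2 ∂M.vol d ≤ C * eLpNorm b s (M.vol d) ^ 2 *
        ∫⁻ x, (‖gradient v x‖ₑ ^ 2 + ‖v x‖ₑ ^ 2) ∂M.vol d := by
  obtain ⟨Q, C, hQ, hC⟩ := exists_setLIntegral_unitCell_le hd hs
  obtain ⟨N, hN⟩ := exists_nat_setLIntegral_le hQ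
  refine ⟨C * N, fun b v hb hv => ?_⟩
  have hbm := aestronglyMeasurable_volume hb.1 hb.2.1
  have hv1 : ContDiff ℝ 1 v := hv.1.of_le (by simp)
  cases M
  · let f : Space d → ℝ≥0∞ := fun x => ‖gradient v x‖ₑ ^ 2 + ‖v x‖ₑ ^ 2
    -- Folding `f` over the lattice gives a periodic function, so bounded overlap becomes the
    -- covering estimate `hN` on the torus.
    let f' : Space d → ℝ≥0∞ := fun x => ∑' g : lattice d, f (g +ᵥ x)
    have hf' : torus.IsFunction f' := by
      rw [isFunction_iff]
      intro (h : lattice d) x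
      simp only [f']
      rw [← (Equiv.addRight h).tsum_eq (fun g : lattice d => f (g +ᵥ x))]
      simp only [Equiv.coe_addRight, add_vadd]
      rfl
    have hf : Measurable f :=
      ((continuous_gradient hv.1).enorm.measurable.pow_const 2).add
        (hv.1.continuous.enorm.measurable.pow_const 2)
    have hfg : ∀ g : lattice d, Measurable fun x => f (g +ᵥ x) := fun g =>
      hf.comp (measurable_const_vadd g)
    have hfd := isAddFundamentalDomain_unitCell d
    change ∫⁻ x, ‖v x • b x‖ₑ ^ 2 ≤ _ * eLpNorm b s volume ^ 2 * ∫⁻ x, f x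
    calc ∫⁻ x, ‖v x • b x‖ₑ ^ 2
        = ∑' g : lattice d, ∫⁻ x in unitCell d, ‖v (g +ᵥ x) • b (g +ᵥ x)‖ₑ ^ 2 :=
          hfd.lintegral_eq_tsum'' _
      _ ≤ ∑' g : lattice d, C * eLpNorm b s volume ^ 2 * ∫⁻ x in Q, f (g +ᵥ x) := by
          refine ENNReal.tsum_le_tsum fun g => ?_
          have hmp := measurePreserving_add_left (volume : Measure (Space d)) (g : Space d)
          have h := hC (fun x => b (g +ᵥ x)) (fun x => v (g +ᵥ x))
            (hbm.comp_measurePreserving hmp) (hv1.comp (contDiff_const.add contDiff_id))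
          have h2 : eLpNorm (fun x => b (g +ᵥ x)) s volume = eLpNorm b s volume :=
            eLpNorm_comp_measurePreserving hbm hmp
          have h3 : ∀ x, gradient (fun y => v (g +ᵥ y)) x = gradient v (g +ᵥ x) := fun x => by
            ext i
            rw [gradient_apply, gradient_apply]
            simp only [AddSubgroup.vadd_def, vadd_eq_add]
            rw [fderiv_comp_add_left]
          rw [h2] at h
          simpa only [h3] using h
      _ = C * eLpNorm b s volume ^ 2 * ∫⁻ x in Q, f' x := by
          rw [ENNReal.tsum_mul_left, lintegral_tsum fun g => (hfg g).aemeasurable]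
      _ ≤ C * eLpNorm b s volume ^ 2 * (N * ∫⁻ x, f' x ∂torus.vol d) :=
          mul_le_mul_right (hN f' hf') _
      _ = C * eLpNorm b s volume ^ 2 * (N * ∫⁻ x, f x) := by
          rw [hfd.lintegral_eq_tsum'' f, ← lintegral_tsum fun g => (hfg g).aemeasurable]
          rfl
      _ = _ := by push_cast; ring
  · have h := hC ((unitCell d).indicator b) v (hbm.indicator (measurableSet_unitCell d)) hv1
    have h1 : eLpNorm ((unitCell d).indicator b) s volume = eLpNorm b s (torus.vol d) :=
      eLpNorm_indicator_eq_eLpNorm_restrict (measurableSet_unitCell d)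
    have h2 : ∫⁻ x in unitCell d, ‖v x • (unitCell d).indicator b x‖ₑ ^ 2 =
        ∫⁻ x, ‖v x • b x‖ₑ ^ 2 ∂torus.vol d :=
      setLIntegral_congr_fun (measurableSet_unitCell d) fun x hx => by simp [hx]
    rw [h1, h2] at h
    refine (h.trans (mul_le_mul_right (hN _ ?_) _)).trans (le_of_eq ?_)
    · exact (isFunction_gradient hv.2.1).comp₂ hv.2.1 fun a b => ‖a‖ₑ ^ 2 + ‖b‖ₑ ^ 2
    · push_cast; ring

/-- The drift `b` is form bounded with respect to the Laplacian, with relative bound `1`. -/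
def IsFormBounded (M : FlatDomain) (b : Space d → Space d) : Prop :=
  ∃ C : NNReal, ∀ v : Space d → ℝ, M.IsTest v →
    eLpNorm (fun x => v x • b x) 2 (M.vol d) ^ 2 ≤
      eLpNorm (gradient v) 2 (M.vol d) ^ 2 + C * eLpNorm v 2 (M.vol d) ^ 2

lemma isFormBounded_of_inLp_top {b : Space d → Space d} (hb : M.InLp b ⊤) :
    M.IsFormBounded b := by
  refine ⟨(eLpNorm b ⊤ (M.vol d)).toNNReal ^ 2, fun v hv => ?_⟩
  rw [ENNReal.coe_pow, ENNReal.coe_toNNReal hb.2.2.ne, ← mul_pow, mul_comm]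
  refine le_add_left (pow_le_pow_left' ?_ 2)
  exact eLpNorm_smul_le_mul_eLpNorm (r := 2) (p := 2) (q := ⊤) (f := b) (φ := v) hb.2.1
    hv.1.continuous.aestronglyMeasurable

lemma exists_eLpNorm_indicator_le {s : NNReal} {b : Space d → Space d} {μ : Measure (Space d)}
    (hb : MemLp b s μ) {ε : ℝ} (hε : 0 < ε) :
    ∃ R : ℝ, eLpNorm ({x | R ≤ ‖b x‖}.indicator b) s μ ≤ ENNReal.ofReal ε := by
  obtain ⟨b', hb', hbb'⟩ := hb.1
  obtain ⟨R, hR⟩ := (hb.ae_eq hbb').eLpNorm_indicator_norm_ge_le hb' hε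
  refine ⟨R, (eLpNorm_congr_ae ?_).le.trans hR⟩
  filter_upwards [hbb'] with x hx
  by_cases h : R ≤ ‖b' x‖ <;> simp [Set.indicator, hx, h]

/-- Split `b` at height `R`. The part above `R` is small in `L^s`, which brings the Sobolev constant
down to `1`; the part below is bounded and adds only `R²‖v‖²`. Hence the size of `b` enters through
`R` alone. -/
lemma isFormBounded_of_inLp (hd : 2 ≤ d) {s : NNReal} (hs : IsSobolevExponent d s)
    {b : Space d → Space d} (hb : M.InLp b s) : M.IsFormBounded b := by
  obtain ⟨C, hC⟩ := exists_lintegral_smul_le hd hs M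
  -- This `ε` satisfies `C ε² = C / (C + 1) ≤ 1`.
  obtain ⟨R, hR⟩ := exists_eLpNorm_indicator_le hb.2 (ε := (√(C + 1))⁻¹) (by positivity)
  set S := {x | R ≤ ‖b x‖}
  have hbS : M.InLp (S.indicator b) s := by
    refine ⟨?_, hb.2.1.indicator₀ (nullMeasurableSet_le aemeasurable_const hb.2.1.norm.aemeasurable),
      (eLpNorm_indicator_le b).trans_lt hb.2.2⟩
    classical
    have := hb.1.comp fun y => if R ≤ ‖y‖ then y else 0
    convert this using 2
    simp [Set.indicator_apply, S]
  have hCS : C * eLpNorm (S.indicator b) s (M.vol d) ^ 2 ≤ 1 := by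
    refine (mul_le_mul_right (pow_le_pow_left' hR 2) _).trans ?_
    rw [← ENNReal.ofReal_pow (by positivity), inv_pow, Real.sq_sqrt (by positivity),
      ← ENNReal.ofReal_coe_nnreal, ← ENNReal.ofReal_mul C.coe_nonneg, ENNReal.ofReal_le_one,
      ← div_eq_mul_inv, div_le_one (by positivity)]
    linarith
  refine ⟨1 + R.toNNReal ^ 2, fun v hv => ?_⟩
  simp only [eLpNorm_two_sq]
  have h1 := (hC _ v hbS hv).trans (mul_le_mul_left hCS _)
  have hgm : Measurable fun x => ‖gradient v x‖ₑ ^ 2 :=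
    (continuous_gradient hv.1).enorm.measurable.pow_const 2
  have hvm : Measurable fun x => ‖v x‖ₑ ^ 2 := hv.1.continuous.enorm.measurable.pow_const 2
  rw [one_mul, lintegral_add_left hgm] at h1
  calc ∫⁻ x, ‖v x • b x‖ₑ ^ 2 ∂M.vol d
      ≤ ∫⁻ x, (‖v x • S.indicator b x‖ₑ ^ 2 + R.toNNReal ^ 2 * ‖v x‖ₑ ^ 2) ∂M.vol d := by
        refine lintegral_mono fun x => ?_
        by_cases hx : x ∈ S
        · simp [hx]
        · have h2 : ‖b x‖ₑ ≤ R.toNNReal := by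
            rw [enorm_eq_nnnorm]
            have : ‖b x‖ ≤ R := (not_le.1 hx).le
            exact_mod_cast NNReal.le_toNNReal_of_coe_le this
          simp only [hx, not_false_eq_true, Set.indicator_of_notMem, smul_zero, enorm_zero]
          rw [enorm_smul, mul_pow, mul_comm]
          refine le_add_left (mul_le_mul_left (pow_le_pow_left' h2 2) _)
    _ = ∫⁻ x, ‖v x • S.indicator b x‖ₑ ^ 2 ∂M.vol d
          + R.toNNReal ^ 2 * ∫⁻ x, ‖v x‖ₑ ^ 2 ∂M.vol d := by
        rw [MeasureTheory.lintegral_add_right _ (hvm.const_mul _), lintegral_const_mul _ hvm]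
    _ ≤ _ := by
        refine (add_le_add_left h1 _).trans (le_of_eq ?_)
        push_cast
        ring

end FlatDomain

/-! ### Extension of the form bound to `H¹`; antisymmetric matrix fields -/

namespace FlatDomain
open scoped Pointwise
variable {d : ℕ} {M : FlatDomain} {F : Type*} [NormedAddCommGroup F]

/-- The test functions `φ j` converge to `u`, with gradients converging to `Du`. -/
structure IsApprox (M : FlatDomain) (φ : ℕ → Space d → ℝ) (u : Space d → ℝ)
    (Du : Space d → Space d) : Prop where
  isTest : ∀ j, M.IsTest (φ j)
  tendsto : Tendsto (fun j => eLpNorm (fun x => φ j x - u x) 2 (M.vol d)) atTop (𝓝 0)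
  tendsto_gradient :
    Tendsto (fun j => eLpNorm (fun x => gradient (φ j) x - Du x) 2 (M.vol d)) atTop (𝓝 0)
  ae_tendsto : ∀ᵐ x ∂M.vol d, Tendsto (fun j => φ j x) atTop (𝓝 (u x))

lemma eLpNorm_le_sub_add {α : Type*} {m : MeasurableSpace α} {μ : Measure α} {f g : α → F}
    (hf : AEStronglyMeasurable f μ) (hg : AEStronglyMeasurable g μ) :
    eLpNorm f 2 μ ≤ eLpNorm (fun x => f x - g x) 2 μ + eLpNorm g 2 μ := by
  have := eLpNorm_add_le (hf.sub hg) hg (p := 2) (by norm_num)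
  rwa [sub_add_cancel] at this

/-- Fatou's lemma on the left, along the almost everywhere convergent `φ j`, and norm convergence on
the right. -/
lemma IsApprox.eLpNorm_smul_le {φ : ℕ → Space d → ℝ} {u : Space d → ℝ} {Du : Space d → Space d}
    (h : M.IsApprox φ u Du) (hu : MemLp u 2 (M.vol d)) (hDu : MemLp Du 2 (M.vol d))
    {b : Space d → Space d} (hbm : AEStronglyMeasurable b (M.vol d)) {C : NNReal}
    (hb : ∀ v : Space d → ℝ, M.IsTest v →
    eLpNorm (fun x => v x • b x) 2 (M.vol d) ^ 2 ≤
      eLpNorm (gradient v) 2 (M.vol d) ^ 2 + C * eLpNorm v 2 (M.vol d) ^ 2) :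
    eLpNorm (fun x => u x • b x) 2 (M.vol d) ^ 2 ≤
      eLpNorm Du 2 (M.vol d) ^ 2 + C * eLpNorm u 2 (M.vol d) ^ 2 := by
  have hm : ∀ j, AEStronglyMeasurable (φ j) (M.vol d) := fun j =>
    (h.isTest j).1.continuous.aestronglyMeasurable
  have hle : ∀ j, eLpNorm (fun x => φ j x • b x) 2 (M.vol d) ^ 2 ≤
      (eLpNorm (fun x => gradient (φ j) x - Du x) 2 (M.vol d) + eLpNorm Du 2 (M.vol d)) ^ 2 +
      C * (eLpNorm (fun x => φ j x - u x) 2 (M.vol d) + eLpNorm u 2 (M.vol d)) ^ 2 := fun j =>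
    (hb _ (h.isTest j)).trans (add_le_add (pow_le_pow_left' (eLpNorm_le_sub_add
      (continuous_gradient (h.isTest j).1).aestronglyMeasurable hDu.1) 2)
      (mul_le_mul_right (pow_le_pow_left' (eLpNorm_le_sub_add (hm j) hu.1) 2) _))
  have hlim : Tendsto (fun j =>
      (eLpNorm (fun x => gradient (φ j) x - Du x) 2 (M.vol d) + eLpNorm Du 2 (M.vol d)) ^ 2 +
      C * (eLpNorm (fun x => φ j x - u x) 2 (M.vol d) + eLpNorm u 2 (M.vol d)) ^ 2) atTop
      (𝓝 (eLpNorm Du 2 (M.vol d) ^ 2 + C * eLpNorm u 2 (M.vol d) ^ 2)) := by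
    have h1 := ENNReal.Tendsto.pow (n := 2)
      (h.tendsto_gradient.add_const (eLpNorm Du 2 (M.vol d)))
    have h2 := ENNReal.Tendsto.pow (n := 2) (h.tendsto.add_const (eLpNorm u 2 (M.vol d)))
    rw [zero_add] at h1 h2
    exact h1.add (ENNReal.Tendsto.const_mul h2 (Or.inr ENNReal.coe_ne_top))
  rw [← hlim.liminf_eq]
  refine le_trans ?_ (liminf_le_liminf (Eventually.of_forall hle))
  simp only [eLpNorm_two_sq]
  refine le_trans (le_of_eq ?_) (lintegral_liminf_le' fun j => ((hm j).smul hbm).enorm.pow_const 2)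
  refine lintegral_congr_ae ?_
  filter_upwards [h.ae_tendsto] with x hx
  have h1 : Tendsto (fun j => ‖φ j x • b x‖ₑ ^ 2) atTop (𝓝 (‖u x • b x‖ₑ ^ 2)) :=
    ENNReal.Tendsto.pow (n := 2) (hx.smul_const (b x)).enorm
  exact h1.liminf_eq.symm

/-- Makes the extended form bound available for the errors `u - φ j`, which are in `H¹` but need not
be test functions. -/
lemma IsApprox.sub_isTest {φ : ℕ → Space d → ℝ} {u : Space d → ℝ} {Du : Space d → Space d}
    (h : M.IsApprox φ u Du) {ψ : Space d → ℝ} (hψ : M.IsTest ψ) :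
    M.IsApprox (fun j x => φ j x - ψ x) (fun x => u x - ψ x) (fun x => Du x - gradient ψ x) where
  isTest j := (h.isTest j).sub hψ
  tendsto := by simpa using h.tendsto
  tendsto_gradient := by
    refine h.tendsto_gradient.congr fun j => ?_
    congr 1; ext1 x
    rw [gradient_sub (h.isTest j).differentiable.differentiableAt
      hψ.differentiable.differentiableAt]
    abel
  ae_tendsto := by
    filter_upwards [h.ae_tendsto] with x hx
    exact hx.sub_const _

lemma IsApprox.tendsto_eLpNorm_sub_smul {φ : ℕ → Space d → ℝ} {u : Space d → ℝ}
    {Du : Space d → Space d}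
    (h : M.IsApprox φ u Du) (hu : MemLp u 2 (M.vol d)) (hDu : MemLp Du 2 (M.vol d))
    {b : Space d → Space d} (hbm : AEStronglyMeasurable b (M.vol d)) (hb : M.IsFormBounded b) :
    Tendsto (fun j => eLpNorm (fun x => (φ j x - u x) • b x) 2 (M.vol d)) atTop (𝓝 0) := by
  obtain ⟨C, hC⟩ := hb
  have hle : ∀ j, eLpNorm (fun x => (φ j x - u x) • b x) 2 (M.vol d) ^ 2 ≤
      eLpNorm (fun x => gradient (φ j) x - Du x) 2 (M.vol d) ^ 2 +
        C * eLpNorm (fun x => φ j x - u x) 2 (M.vol d) ^ 2 := by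
    intro j
    have h1 := (h.sub_isTest (h.isTest j)).eLpNorm_smul_le
      (hu.sub ((h.isTest j).inLp 2).2) (hDu.sub ((h.isTest j).inLp_gradient 2).2) hbm hC
    have e1 : eLpNorm (fun x => (φ j x - u x) • b x) 2 (M.vol d) =
        eLpNorm (fun x => (u x - φ j x) • b x) 2 (M.vol d) := by
      rw [← eLpNorm_neg]; congr 1; ext1 x; simp [← neg_smul]
    have e2 := eLpNorm_sub_comm (gradient (φ j)) Du 2 (M.vol d)
    have e3 := eLpNorm_sub_comm (φ j) u 2 (M.vol d)
    simp only [Pi.sub_def] at e2 e3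
    rwa [e1, e2, e3]
  have hlim := (ENNReal.Tendsto.pow (n := 2) h.tendsto_gradient).add
    (ENNReal.Tendsto.const_mul (ENNReal.Tendsto.pow (n := 2) h.tendsto) (Or.inr (ENNReal.coe_ne_top (r := C))))
  simp only [ne_eq, OfNat.ofNat_ne_zero, not_false_eq_true, zero_pow, mul_zero, add_zero] at hlim
  have h2 := tendsto_of_tendsto_of_tendsto_of_le_of_le tendsto_const_nhds hlim
    (fun _ => zero_le) hle
  have h3 := ((ENNReal.continuous_rpow_const (y := 1 / 2)).tendsto _).comp h2
  rw [ENNReal.zero_rpow_of_pos (by norm_num)] at h3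
  refine h3.congr fun j => ?_
  simp only [Function.comp_apply]
  rw [← ENNReal.rpow_natCast, ← ENNReal.rpow_mul]
  norm_num

lemma tendsto_integral_inner_of_tendsto {V : Type*} [NormedAddCommGroup V] [InnerProductSpace ℝ V]
    {α : Type*} {m : MeasurableSpace α} {μ : Measure α} {H f : α → V} {fj : ℕ → α → V}
    (hH : MemLp H 2 μ) (hf : MemLp f 2 μ) (hfj : ∀ j, MemLp (fj j) 2 μ)
    (h : Tendsto (fun j => eLpNorm (fun x => fj j x - f x) 2 μ) atTop (𝓝 0)) :
    Tendsto (fun j => ∫ x, inner ℝ (H x) (fj j x) ∂μ) atTop (𝓝 (∫ x, inner ℝ (H x) (f x) ∂μ)) := by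
  have h1 := ENNReal.Tendsto.const_mul h (Or.inr hH.2.ne)
  rw [mul_zero] at h1
  rw [tendsto_iff_edist_tendsto_0]
  refine tendsto_of_tendsto_of_tendsto_of_le_of_le tendsto_const_nhds h1 (fun _ => zero_le)
    fun j => ?_
  rw [edist_eq_enorm_sub, ← integral_sub (integrable_inner hH (hfj j)) (integrable_inner hH hf)]
  simp only [← inner_sub_right]
  exact enorm_integral_inner_le 2 2 hH.1 ((hfj j).sub hf).1

lemma memLp_matVec {α : Type*} {m : MeasurableSpace α} {μ : Measure α} {p q r : ℝ≥0∞}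
    [ENNReal.HolderTriple p q r] {A : α → Matrix (Fin d) (Fin d) ℝ} {ξ : α → Space d}
    (hA : ∀ i j, MemLp (fun x => A x i j) p μ) (hξ : MemLp ξ q μ) :
    MemLp (fun x => matVec (A x) (ξ x)) r μ := by
  refine MemLp.of_eval_piLp fun i => ?_
  simp only [matVec, Matrix.mulVec, dotProduct]
  exact memLp_finsetSum _ fun j _ => (hξ.eval_piLp j).mul (hA i j)

lemma matVec_smul (c : ℝ) (A : Matrix (Fin d) (Fin d) ℝ) (ξ : Space d) :
    matVec (c • A) ξ = c • matVec A ξ := by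
  ext i
  simp [matVec, Matrix.smul_mulVec]

lemma inner_matVec_of_transpose_eq_neg {A : Matrix (Fin d) (Fin d) ℝ} (hA : A.transpose = -A)
    (ξ ζ : Space d) : inner ℝ (matVec A ξ) ζ = - inner ℝ (matVec A ζ) ξ := by
  have h : ∀ i j, A i j = - A j i := fun i j => by
    have := congrFun (congrFun hA j) i
    simpa using this
  simp only [PiLp.inner_apply, matVec, Matrix.mulVec, dotProduct, RCLike.inner_apply, conj_trivial,
    Finset.mul_sum]
  rw [Finset.sum_comm, ← Finset.sum_neg_distrib]
  refine Finset.sum_congr rfl fun i _ => ?_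
  rw [← Finset.sum_neg_distrib]
  refine Finset.sum_congr rfl fun j _ => ?_
  rw [h j i]
  simp
  ring

lemma inner_matVec_self {A : Matrix (Fin d) (Fin d) ℝ} (hA : A.transpose = -A)
    (ξ : Space d) : inner ℝ (matVec A ξ) ξ = 0 := by
  have := inner_matVec_of_transpose_eq_neg hA ξ ξ
  linarith

end FlatDomain

/-! ### Testing with a test function times a cutoff -/

namespace FlatDomain
open scoped Pointwise
variable {d : ℕ} {M : FlatDomain} {F : Type*} [NormedAddCommGroup F]

lemma integral_add_add {α : Type*} {m : MeasurableSpace α} {μ : Measure α} {a b c : α → ℝ}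
    (ha : Integrable a μ) (hb : Integrable b μ) (hc : Integrable c μ) :
    ∫ x, (a x + b x + c x) ∂μ = ∫ x, a x ∂μ + ∫ x, b x ∂μ + ∫ x, c x ∂μ := by
  rw [← integral_add ha hb]
  exact integral_add (ha.add hb) hc

/-- A divergence form equation, tested against `ψ g` with a test function `ψ` and a bounded
weakly differentiable `g`. -/
lemma integral_mul_add_integral_inner_eq_zero {f : Space d → ℝ} {F₂ F₃ : Space d → Space d}
    {p q : ℝ≥0∞} [ENNReal.HolderConjugate p q] (hp : p ≠ ⊤)
    (hf : M.IsFunction f) (hfi : ∀ ψ, M.IsTest ψ → Integrable (fun x => f x * ψ x) (M.vol d))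
    (hF₂ : M.InLp F₂ 2) (hF₃ : M.InLp F₃ p)
    (heq : ∀ ψ, M.IsTest ψ → ∫ x, f x * ψ x ∂M.vol d + ∫ x, inner ℝ (F₂ x) (gradient ψ x) ∂M.vol d
      + ∫ x, inner ℝ (F₃ x) (gradient ψ x) ∂M.vol d = 0)
    {g : Space d → ℝ} {Dg : Space d → Space d} (hg : M.InLp g ⊤) (hDg : M.InLp Dg 2)
    (hDg' : M.InLp Dg q) (hw : M.HasWeakGradient g Dg) {ψ : Space d → ℝ} (hψ : M.IsTest ψ) :
    ∫ x, g x * (f x * ψ x + inner ℝ (F₂ x) (gradient ψ x) + inner ℝ (F₃ x) (gradient ψ x)) ∂M.vol d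
      + ∫ x, ψ x * inner ℝ (F₂ x) (Dg x) ∂M.vol d + ∫ x, ψ x * inner ℝ (F₃ x) (Dg x) ∂M.vol d
      = 0 := by
  have hgl := hg.locallyIntegrable le_top
  have hDgl := hDg.locallyIntegrable (by norm_num)
  have hψg := hψ.inLp_gradient
  have hB : M.InLp (fun x => f x * ψ x + inner ℝ (F₂ x) (gradient ψ x) +
      inner ℝ (F₃ x) (gradient ψ x)) 1 := by
    refine ⟨((hf.comp₂ hψ.2.1 _).comp₂ (hF₂.1.comp₂ (hψg 2).1 _) _).comp₂ (hF₃.1.comp₂ (hψg q).1 _) _,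
      ?_⟩
    exact memLp_one_iff_integrable.2 (((hfi ψ hψ).add (integrable_inner hF₂.2 (hψg 2).2)).add
      (integrable_inner hF₃.2 (hψg q).2))
  have h2 : M.InLp (fun x => ψ x • F₂ x) 2 :=
    ⟨hψ.2.1.comp₂ hF₂.1 _, hF₂.2.smul (hψ.inLp ⊤).2⟩
  have h3 : M.InLp (fun x => ψ x • F₃ x) p :=
    ⟨hψ.2.1.comp₂ hF₃.1 _, hF₃.2.smul (hψ.inLp ⊤).2⟩
  -- The factor multiplying `g` is only integrable, so it is paired in `L¹`–`L^∞`, where weak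
  -- convergence of the mollifications of `g` is all there is. The factors multiplying `Dg` use the
  -- exponents `2, 2` and `p, q`.
  have L1 := tendsto_integral_inner_mollify (p := 1) (q := ⊤) (by simp) hB hg
  have L2 := tendsto_integral_inner_mollify (p := 2) (q := 2) (by simp) h2 hDg
  have L3 := tendsto_integral_inner_mollify (p := p) (q := q) hp h3 hDg'
  have L := (L1.add L2).add L3
  -- The equation tested with `ψ` times the mollified `g`, expanded by the product rule.
  have hzero : ∀ j, ∫ x, inner ℝ (f x * ψ x + inner ℝ (F₂ x) (gradient ψ x) +
      inner ℝ (F₃ x) (gradient ψ x)) (mollify j g x) ∂M.vol d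
      + ∫ x, inner ℝ (ψ x • F₂ x) (mollify j Dg x) ∂M.vol d
      + ∫ x, inner ℝ (ψ x • F₃ x) (mollify j Dg x) ∂M.vol d = 0 := by
    intro j
    have hs := contDiff_mollify hgl j
    have hφ : M.IsTest (fun x => ψ x * mollify j g x) := hψ.mul hs (hg.1.mollify j)
    have hgr : ∀ x, gradient (fun x => ψ x * mollify j g x) x =
        ψ x • mollify j Dg x + mollify j g x • gradient ψ x := fun x => by
      rw [gradient_mul hψ.differentiable.differentiableAt
        (hs.differentiable (by simp)).differentiableAt, gradient_mollify hw hgl hDgl]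
    have c1 : ∀ r, M.InLp (fun x => ψ x • mollify j Dg x) r :=
      inLp_of_continuous_of_test (hψ.1.continuous.smul (contDiff_mollify hDgl j).continuous)
        (hψ.2.1.comp₂ (hDg.1.mollify j) _) fun h => (hψ.hasCompactSupport h).smul_right
    have c2 : ∀ r, M.InLp (fun x => mollify j g x • gradient ψ x) r := by
      have hc : M = euclidean → HasCompactSupport (fun x => mollify j g x • gradient ψ x) :=
        fun h => HasCompactSupport.smul_left (f := mollify j g) (f' := gradient ψ)
          (hψ.hasCompactSupport_gradient h)
      exact inLp_of_continuous_of_test (hs.continuous.smul (continuous_gradient hψ.1))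
        ((hg.1.mollify j).comp₂ (hψg 2).1 _) hc
    have e := heq _ hφ
    simp only [hgr, inner_add_right] at e
    rw [integral_add (integrable_inner hF₂.2 (c1 2).2) (integrable_inner hF₂.2 (c2 2).2),
      integral_add (integrable_inner hF₃.2 (c1 q).2) (integrable_inner hF₃.2 (c2 q).2)] at e
    have e1 : ∫ x, inner ℝ (f x * ψ x + inner ℝ (F₂ x) (gradient ψ x) +
        inner ℝ (F₃ x) (gradient ψ x)) (mollify j g x) ∂M.vol d =
        ∫ x, f x * (ψ x * mollify j g x) ∂M.vol d
        + ∫ x, inner ℝ (F₂ x) (mollify j g x • gradient ψ x) ∂M.vol d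
        + ∫ x, inner ℝ (F₃ x) (mollify j g x • gradient ψ x) ∂M.vol d := by
      rw [← integral_add_add (hfi _ hφ) (integrable_inner hF₂.2 (c2 2).2)
        (integrable_inner hF₃.2 (c2 q).2)]
      congr 1; ext1 x
      simp only [RCLike.inner_apply, conj_trivial, inner_smul_right]
      ring
    have e2 : ∀ G : Space d → Space d, ∫ x, inner ℝ (ψ x • G x) (mollify j Dg x) ∂M.vol d =
        ∫ x, inner ℝ (G x) (ψ x • mollify j Dg x) ∂M.vol d := fun G => by
      simp only [inner_smul_left, inner_smul_right, conj_trivial]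
    rw [e1, e2, e2]
    linarith
  simp only [hzero] at L
  have := tendsto_nhds_unique L tendsto_const_nhds
  simpa [inner_smul_left] using this

end FlatDomain

/-! ### Testing with a truncation of the solution times a cutoff -/

namespace FlatDomain
open scoped Pointwise
variable {d : ℕ} {M : FlatDomain} {F : Type*} [NormedAddCommGroup F]

/-- A smooth, bounded, `1`-Lipschitz truncation function vanishing at the origin. -/
structure IsTruncation (T : ℝ → ℝ) : Prop where
  contDiff : ContDiff ℝ ∞ T
  map_zero : T 0 = 0
  bounded : ∃ K, ∀ s, ‖T s‖ ≤ K
  norm_sub_le : ∀ s t, ‖T s - T t‖ ≤ ‖s - t‖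
  norm_deriv_le : ∀ s, ‖deriv T s‖ ≤ 1

lemma IsTruncation.norm_le {T : ℝ → ℝ} (hT : IsTruncation T) (s : ℝ) : ‖T s‖ ≤ ‖s‖ := by
  simpa [hT.map_zero] using hT.norm_sub_le s 0

lemma IsTruncation.continuous_deriv {T : ℝ → ℝ} (hT : IsTruncation T) : Continuous (deriv T) :=
  hT.contDiff.continuous_deriv (by simp)

lemma IsFormBounded.memLp_test {b : Space d → Space d} (hb : M.IsFormBounded b)
    (hbm : AEStronglyMeasurable b (M.vol d)) {v : Space d → ℝ} (hv : M.IsTest v) :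
    MemLp (fun x => v x • b x) 2 (M.vol d) := by
  obtain ⟨C, hC⟩ := hb
  refine ⟨hv.1.continuous.aestronglyMeasurable.smul hbm, ?_⟩
  have h1 : eLpNorm (fun x => v x • b x) 2 (M.vol d) ^ 2 < ⊤ := (hC v hv).trans_lt
    (ENNReal.add_lt_top.2 ⟨ENNReal.pow_lt_top (hv.inLp_gradient 2).2.2,
      ENNReal.mul_lt_top ENNReal.coe_lt_top (ENNReal.pow_lt_top (hv.inLp 2).2.2)⟩)
  exact (ENNReal.pow_lt_top_iff.1 h1).resolve_right (by simp)

lemma IsApprox.memLp_smul {φ : ℕ → Space d → ℝ} {u : Space d → ℝ} {Du : Space d → Space d}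
    (h : M.IsApprox φ u Du) (hu : MemLp u 2 (M.vol d)) (hDu : MemLp Du 2 (M.vol d))
    {b : Space d → Space d} (hbm : AEStronglyMeasurable b (M.vol d)) (hb : M.IsFormBounded b) :
    MemLp (fun x => u x • b x) 2 (M.vol d) := by
  obtain ⟨C, hC⟩ := hb
  refine ⟨hu.1.smul hbm, ?_⟩
  have h1 : eLpNorm (fun x => u x • b x) 2 (M.vol d) ^ 2 < ⊤ :=
    (h.eLpNorm_smul_le hu hDu hbm hC).trans_lt
    (ENNReal.add_lt_top.2 ⟨ENNReal.pow_lt_top hDu.2,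
      ENNReal.mul_lt_top ENNReal.coe_lt_top (ENNReal.pow_lt_top hu.2)⟩)
  exact (ENNReal.pow_lt_top_iff.1 h1).resolve_right (by simp)

/-- In the chain rule, `T'(φ j)` converges only pointwise; the error `(T'(φ j) - T'(u)) Du` is
dominated by `2‖Du‖`. -/
lemma IsApprox.tendsto_gradient_comp {φ : ℕ → Space d → ℝ} {u : Space d → ℝ}
    {Du : Space d → Space d} (h : M.IsApprox φ u Du) (hu : MemLp u 2 (M.vol d))
    (hDu : MemLp Du 2 (M.vol d)) {T : ℝ → ℝ} (hT : IsTruncation T) :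
    Tendsto (fun j => eLpNorm (fun x => gradient (fun y => T (φ j y)) x - deriv T (u x) • Du x) 2
      (M.vol d)) atTop (𝓝 0) := by
  have hφc : ∀ j, Continuous (φ j) := fun j => (h.isTest j).1.continuous
  have m1 : ∀ j, AEStronglyMeasurable (fun x => deriv T (φ j x) • (gradient (φ j) x - Du x))
      (M.vol d) := fun j => (hT.continuous_deriv.comp (hφc j)).aestronglyMeasurable.smul
        ((continuous_gradient (h.isTest j).1).aestronglyMeasurable.sub hDu.1)
  have m2 : ∀ j, AEStronglyMeasurable (fun x => (deriv T (φ j x) - deriv T (u x)) • Du x)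
      (M.vol d) := fun j => ((hT.continuous_deriv.comp (hφc j)).aestronglyMeasurable.sub
        (hT.continuous_deriv.comp_aestronglyMeasurable hu.1)).smul hDu.1
  have h2 : Tendsto (fun j => eLpNorm (fun x => (deriv T (φ j x) - deriv T (u x)) • Du x) 2
      (M.vol d)) atTop (𝓝 0) := by
    refine tendsto_eLpNorm_two_of_dominated (B := fun x => 2 * ‖Du x‖) m2 (hDu.norm.const_mul 2)
      (fun j => Eventually.of_forall fun x => ?_) ?_
    · rw [Real.norm_of_nonneg (by positivity), norm_smul]
      refine mul_le_mul_of_nonneg_right ((norm_sub_le _ _).trans ?_) (norm_nonneg _)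
      linarith [hT.norm_deriv_le (φ j x), hT.norm_deriv_le (u x)]
    · filter_upwards [h.ae_tendsto] with x hx
      have h3 := ((hT.continuous_deriv.tendsto (u x)).comp hx).sub_const (deriv T (u x))
      simpa using h3.smul_const (Du x)
  have hb := h.tendsto_gradient.add h2
  rw [add_zero] at hb
  refine tendsto_of_tendsto_of_tendsto_of_le_of_le tendsto_const_nhds hb (fun _ => zero_le)
    fun j => ?_
  have he : (fun x => gradient (fun y => T (φ j y)) x - deriv T (u x) • Du x) =
      (fun x => deriv T (φ j x) • (gradient (φ j) x - Du x)) +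
        fun x => (deriv T (φ j x) - deriv T (u x)) • Du x := by
    ext1 x
    rw [gradient_comp (hT.contDiff.differentiable (by simp)).differentiableAt
      (h.isTest j).differentiable.differentiableAt, Pi.add_apply, smul_sub, sub_smul]
    abel
  rw [he]
  refine (eLpNorm_add_le (m1 j) (m2 j) (by norm_num)).trans (add_le_add_left
    (eLpNorm_mono fun x => ?_) _)
  rw [norm_smul]
  exact mul_le_of_le_one_left (norm_nonneg _) (hT.norm_deriv_le _)

/-- The equation tested against `T(u) g`, for a truncation `T` and a cutoff `g`. -/
lemma integral_truncation_eq_zero {u : Space d → ℝ} {Du b F₂ F₃ : Space d → Space d}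
    {φ : ℕ → Space d → ℝ} {lam c₁ : ℝ}
    {p q : ℝ≥0∞} [ENNReal.HolderConjugate p q] (hp : p ≠ ⊤)
    (hu : M.InLp u 2) (hDu : M.InLp Du 2) (h : M.IsApprox φ u Du)
    (hbM : M.IsFunction b) (hbm : AEStronglyMeasurable b (M.vol d)) (hb : M.IsFormBounded b)
    (hF₂ : M.InLp F₂ 2) (hF₃ : M.InLp F₃ p) (hanti : ∀ᵐ x ∂M.vol d, inner ℝ (F₃ x) (Du x) = 0)
    (heq : ∀ ψ, M.IsTest ψ →
      ∫ x, (lam * u x - c₁ * inner ℝ (Du x) (b x)) * ψ x ∂M.vol d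
      + ∫ x, inner ℝ (F₂ x) (gradient ψ x) ∂M.vol d
      + ∫ x, inner ℝ (F₃ x) (gradient ψ x) ∂M.vol d = 0)
    {g : Space d → ℝ} {Dg : Space d → Space d} (hg : M.InLp g ⊤) (hDg : M.InLp Dg 2)
    (hDg' : M.InLp Dg q) (hw : M.HasWeakGradient g Dg)
    (hgF₃ : MemLp (fun x => g x • F₃ x) 2 (M.vol d)) {T : ℝ → ℝ} (hT : IsTruncation T) :
    lam * ∫ x, g x * (u x * T (u x)) ∂M.vol d
      - c₁ * ∫ x, g x * inner ℝ (Du x) (T (u x) • b x) ∂M.vol d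
      + ∫ x, g x * inner ℝ (F₂ x) (deriv T (u x) • Du x) ∂M.vol d
      + ∫ x, T (u x) * inner ℝ (F₂ x) (Dg x) ∂M.vol d
      + ∫ x, T (u x) * inner ℝ (F₃ x) (Dg x) ∂M.vol d = 0 := by
  set μ := M.vol d with hμ
  obtain ⟨K, hK⟩ := hT.bounded
  have hψ : ∀ j, M.IsTest (fun x => T (φ j x)) := fun j => (h.isTest j).comp hT.contDiff hT.map_zero
  have hψb : ∀ j, MemLp (fun x => T (φ j x) • b x) 2 μ := fun j => hb.memLp_test hbm (hψ j)
  have hTm : AEStronglyMeasurable (fun x => T (u x)) μ :=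
    hT.contDiff.continuous.comp_aestronglyMeasurable hu.2.1
  have hθ : MemLp (fun x => T (u x)) 2 μ :=
    hu.2.mono hTm (Eventually.of_forall fun x => hT.norm_le _)
  have hθb : MemLp (fun x => T (u x) • b x) 2 μ :=
    (h.memLp_smul hu.2 hDu.2 hbm hb).mono (hTm.smul hbm) (Eventually.of_forall fun x => by
      rw [norm_smul, norm_smul]
      exact mul_le_mul_of_nonneg_right (hT.norm_le _) (norm_nonneg _))
  have hDθ : MemLp (fun x => deriv T (u x) • Du x) 2 μ :=
    hDu.2.mono ((hT.continuous_deriv.comp_aestronglyMeasurable hu.2.1).smul hDu.2.1)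
      (Eventually.of_forall fun x => by
        rw [norm_smul]
        exact mul_le_of_le_one_left (norm_nonneg _) (hT.norm_deriv_le _))
  have hgu : MemLp (fun x => g x * u x) 2 μ := hu.2.mul hg.2
  have hgDu : MemLp (fun x => g x • Du x) 2 μ := hDu.2.smul hg.2
  have hgF₂ : MemLp (fun x => g x • F₂ x) 2 μ := hF₂.2.smul hg.2
  have hfi : ∀ ψ, M.IsTest ψ →
      Integrable (fun x => (lam * u x - c₁ * inner ℝ (Du x) (b x)) * ψ x) μ := by
    intro ψ hψ
    have h1 := (hu.2.integrable_mul (hψ.inLp 2).2).const_mul lam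
    have h2 := (integrable_inner hDu.2 (hb.memLp_test hbm hψ)).const_mul c₁
    refine (h1.sub h2).congr (Eventually.of_forall fun x => ?_)
    simp only [Pi.mul_apply, Pi.sub_apply, inner_smul_right]
    ring
  have hfM : M.IsFunction (fun x => lam * u x - c₁ * inner ℝ (Du x) (b x)) :=
    hu.1.comp₂ (hDu.1.comp₂ hbM (inner ℝ)) fun a c => lam * a - c₁ * c
  -- The factor `g` is moved onto the fixed functions. In particular `g F₃` is in `L²`, so it can be
  -- paired with gradients that converge only in `L²`.
  have hE : ∀ j, lam * ∫ x, inner ℝ (g x * u x) (T (φ j x)) ∂μ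
      - c₁ * ∫ x, inner ℝ (g x • Du x) (T (φ j x) • b x) ∂μ
      + ∫ x, inner ℝ (g x • F₂ x) (gradient (fun y => T (φ j y)) x) ∂μ
      + ∫ x, inner ℝ (g x • F₃ x) (gradient (fun y => T (φ j y)) x) ∂μ
      + ∫ x, T (φ j x) * inner ℝ (F₂ x) (Dg x) ∂μ
      + ∫ x, T (φ j x) * inner ℝ (F₃ x) (Dg x) ∂μ = 0 := by
    intro j
    have h1 := integral_mul_add_integral_inner_eq_zero hp hfM hfi hF₂ hF₃ heq hg hDg hDg' hw (hψ j)
    have i1 := (integrable_inner hgu ((hψ j).inLp 2).2).const_mul lam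
    have i2 := (integrable_inner hgDu (hψb j)).const_mul c₁
    have i3 := integrable_inner hgF₂ ((hψ j).inLp_gradient 2).2
    have i4 := integrable_inner hgF₃ ((hψ j).inLp_gradient 2).2
    rw [← h1]
    congr 2
    rw [← integral_const_mul, ← integral_const_mul, ← integral_sub i1 i2]
    refine (integral_add_add (i1.sub i2) i3 i4).symm.trans ?_
    congr 1; ext1 x
    simp only [Pi.sub_apply, inner_smul_left, inner_smul_right, RCLike.inner_apply, conj_trivial]
    ring
  have l1 : Tendsto (fun j => eLpNorm (fun x => T (φ j x) - T (u x)) 2 μ) atTop (𝓝 0) :=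
    tendsto_of_tendsto_of_tendsto_of_le_of_le tendsto_const_nhds h.tendsto (fun _ => zero_le)
      fun j => eLpNorm_mono fun x => hT.norm_sub_le _ _
  have l2 : Tendsto (fun j => eLpNorm (fun x => T (φ j x) • b x - T (u x) • b x) 2 μ) atTop
      (𝓝 0) :=
    tendsto_of_tendsto_of_tendsto_of_le_of_le tendsto_const_nhds
      (h.tendsto_eLpNorm_sub_smul hu.2 hDu.2 hbm hb) (fun _ => zero_le)
      fun j => eLpNorm_mono fun x => by
        rw [← sub_smul, norm_smul, norm_smul]
        exact mul_le_mul_of_nonneg_right (hT.norm_sub_le _ _) (norm_nonneg _)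
  have l3 := h.tendsto_gradient_comp hu.2 hDu.2 hT
  -- The products of `F₂` and `F₃` with `Dg` are merely integrable, so here the boundedness of `T`
  -- is essential.
  have ldom : ∀ k : Space d → ℝ, Integrable k μ →
      Tendsto (fun j => ∫ x, T (φ j x) * k x ∂μ) atTop (𝓝 (∫ x, T (u x) * k x ∂μ)) := by
    intro k hk
    refine tendsto_integral_of_dominated_convergence (fun x => K * ‖k x‖)
      (fun j => (hψ j).1.continuous.aestronglyMeasurable.mul hk.1) (hk.norm.const_mul K)
      (fun j => Eventually.of_forall fun x => ?_) ?_
    · rw [norm_mul]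
      exact mul_le_mul_of_nonneg_right (hK _) (norm_nonneg _)
    · filter_upwards [h.ae_tendsto] with x hx
      exact ((hT.contDiff.continuous.tendsto _).comp hx).mul_const _
  have L := (((((tendsto_integral_inner_of_tendsto hgu hθ (fun j => ((hψ j).inLp 2).2)
    l1).const_mul lam).sub
    ((tendsto_integral_inner_of_tendsto hgDu hθb hψb l2).const_mul c₁)).add
    (tendsto_integral_inner_of_tendsto hgF₂ hDθ (fun j => ((hψ j).inLp_gradient 2).2) l3)).add
    (tendsto_integral_inner_of_tendsto hgF₃ hDθ (fun j => ((hψ j).inLp_gradient 2).2) l3)).add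
    (ldom _ (integrable_inner hF₂.2 hDg.2)) |>.add (ldom _ (integrable_inner hF₃.2 hDg'.2))
  simp only [hE] at L
  have h0 := tendsto_nhds_unique L tendsto_const_nhds
  have hz : ∫ x, inner ℝ (g x • F₃ x) (deriv T (u x) • Du x) ∂μ = 0 := by
    refine integral_eq_zero_of_ae ?_
    filter_upwards [hanti] with x hx
    simp [inner_smul_left, inner_smul_right, hx]
  rw [hz, add_zero] at h0
  rw [← h0]
  simp only [inner_smul_left, RCLike.inner_apply, conj_trivial]
  congr 7
  ext1 x
  ring

end FlatDomain

/-! ### Energy identity and energy inequality -/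

namespace FlatDomain
open scoped Pointwise
variable {d : ℕ} {M : FlatDomain} {F : Type*} [NormedAddCommGroup F]

/-- The truncations `s ↦ k sin (s / k)`, with `k = n + 1`. -/
noncomputable def sinTruncation (n : ℕ) (s : ℝ) : ℝ := (n + 1) * Real.sin (s / (n + 1))

lemma hasDerivAt_sinTruncation (n : ℕ) (s : ℝ) :
    HasDerivAt (sinTruncation n) (Real.cos (s / (n + 1))) s := by
  have hn : (n : ℝ) + 1 ≠ 0 := by positivity
  have h := (((hasDerivAt_id s).div_const ((n : ℝ) + 1)).sin).const_mul ((n : ℝ) + 1)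
  convert! h using 1
  simp only [id]
  field_simp

lemma isTruncation_sinTruncation (n : ℕ) : IsTruncation (sinTruncation n) where
  contDiff := contDiff_const.mul (Real.contDiff_sin.comp (contDiff_id.div_const _))
  map_zero := by simp [sinTruncation]
  bounded := ⟨n + 1, fun s => by
    rw [sinTruncation, norm_mul, Real.norm_of_nonneg (by positivity)]
    exact mul_le_of_le_one_right (by positivity) (Real.abs_sin_le_one _)⟩
  norm_sub_le s t := by
    rw [sinTruncation, sinTruncation, ← mul_sub, norm_mul, Real.norm_of_nonneg (by positivity)]
    refine (mul_le_mul_of_nonneg_left (Real.abs_sin_sub_sin_le _ _) (by positivity)).trans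
      (le_of_eq ?_)
    have hn : (0 : ℝ) < (n : ℝ) + 1 := by positivity
    rw [← sub_div, abs_div, abs_of_pos hn, Real.norm_eq_abs]
    field_simp
  norm_deriv_le s := by
    rw [(hasDerivAt_sinTruncation n s).deriv]
    exact Real.abs_cos_le_one _

lemma tendsto_div_add_one (s : ℝ) : Tendsto (fun n : ℕ => s / ((n : ℝ) + 1)) atTop (𝓝 0) := by
  simpa [div_eq_mul_inv] using (tendsto_one_div_add_atTop_nhds_zero_nat (𝕜 := ℝ)).const_mul s

lemma tendsto_sinTruncation (s : ℝ) : Tendsto (fun n => sinTruncation n s) atTop (𝓝 s) := by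
  have h := ((Real.continuous_sinc.tendsto 0).comp (tendsto_div_add_one s)).const_mul s
  rw [Real.sinc_zero, mul_one] at h
  refine h.congr fun n => ?_
  have hn : (n : ℝ) + 1 ≠ 0 := by positivity
  rcases eq_or_ne s 0 with rfl | hs
  · simp [sinTruncation]
  · simp only [Function.comp_apply, sinTruncation]
    rw [Real.sinc_of_ne_zero (div_ne_zero hs hn)]
    field_simp

lemma tendsto_deriv_sinTruncation (s : ℝ) :
    Tendsto (fun n => deriv (sinTruncation n) s) atTop (𝓝 1) := by
  have h := (Real.continuous_cos.tendsto 0).comp (tendsto_div_add_one s)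
  rw [Real.cos_zero] at h
  exact h.congr fun n => (hasDerivAt_sinTruncation n s).deriv.symm

lemma integral_norm_sq_eq_toReal {α : Type*} {m : MeasurableSpace α} {μ : Measure α} {f : α → F}
    (hf : MemLp f 2 μ) : ∫ x, ‖f x‖ ^ 2 ∂μ = (eLpNorm f 2 μ ^ 2).toReal := by
  have hm : AEStronglyMeasurable (fun x => ‖f x‖ ^ 2) μ := hf.1.norm.pow 2
  rw [eLpNorm_two_sq, integral_eq_lintegral_of_nonneg_ae
    (Eventually.of_forall fun x => by positivity) hm]
  congr 2; ext1 x
  rw [ENNReal.ofReal_pow (norm_nonneg _), ofReal_norm]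

lemma isFunction_matVec {A : Space d → Matrix (Fin d) (Fin d) ℝ} {ξ : Space d → Space d}
    (hA : ∀ i j, M.IsFunction fun x => A x i j) (hξ : M.IsFunction ξ) :
    M.IsFunction fun x => matVec (A x) (ξ x) := by
  simp only [isFunction_iff] at *
  intro g x
  have : A (g +ᵥ x) = A x := by ext i j; exact hA i j g x
  rw [this, hξ]

/-- The energy identity tested against a truncation of the solution. -/
lemma energy_identity {p : ℝ≥0∞} (hp : 2 ≤ p) {A : Space d → Matrix (Fin d) (Fin d) ℝ}
    (hA : M.MatrixInLp A p) (hanti : ∀ᵐ x ∂M.vol d, (A x).transpose = - A x)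
    {g : ℕ → Space d → ℝ} (hg : M.IsCutoffSequence p A g)
    {u : Space d → ℝ} {Du b F₂ : Space d → Space d} {φ : ℕ → Space d → ℝ} {lam c₁ : ℝ}
    (hu : M.InLp u 2) (hDu : M.InLp Du 2) (h : M.IsApprox φ u Du)
    (hbM : M.IsFunction b) (hbm : AEStronglyMeasurable b (M.vol d)) (hb : M.IsFormBounded b)
    (hF₂ : M.InLp F₂ 2)
    (heq : ∀ ψ, M.IsTest ψ →
      ∫ x, (lam * u x - c₁ * inner ℝ (Du x) (b x)) * ψ x ∂M.vol d
      + ∫ x, inner ℝ (F₂ x) (gradient ψ x) ∂M.vol d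
      + ∫ x, inner ℝ (matVec (A x) (Du x)) (gradient ψ x) ∂M.vol d = 0)
    {T : ℝ → ℝ} (hT : IsTruncation T) :
    lam * ∫ x, u x * T (u x) ∂M.vol d - c₁ * ∫ x, inner ℝ (Du x) (T (u x) • b x) ∂M.vol d
      + ∫ x, inner ℝ (F₂ x) (deriv T (u x) • Du x) ∂M.vol d = 0 := by
  obtain ⟨hg1, Dg, hw, hDg, hDg', hweak, hone, hgA, -, hAweak⟩ := hg
  have hple : p⁻¹ ≤ 2⁻¹ := ENNReal.inv_le_inv.2 hp
  set q : ℝ≥0∞ := (2⁻¹ - p⁻¹)⁻¹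
  -- The exponent of `A Du`, by Hölder; `1/s + 1/q = (1/p + 1/2) + (1/2 - 1/p) = 1`.
  set s : ℝ≥0∞ := (p⁻¹ + 2⁻¹)⁻¹ with hs
  have hps : ENNReal.HolderTriple p 2 s := ⟨by rw [hs, inv_inv]⟩
  have hsq : ENNReal.HolderConjugate s q := ⟨by
    rw [hs, inv_inv, inv_inv, add_comm p⁻¹, add_assoc, add_tsub_cancel_of_le hple,
      ENNReal.inv_two_add_inv_two, inv_one]⟩
  have hs_top : s ≠ ⊤ := by simp [hs]
  have hF₃ : M.InLp (fun x => matVec (A x) (Du x)) s :=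
    ⟨isFunction_matVec (fun i j => (hA i j).1) hDu.1, memLp_matVec (fun i j => (hA i j).2) hDu.2⟩
  obtain ⟨K, hK⟩ := hT.bounded
  have hTm : AEStronglyMeasurable (fun x => T (u x)) (M.vol d) :=
    hT.contDiff.continuous.comp_aestronglyMeasurable hu.2.1
  have hθ : MemLp (fun x => T (u x)) 2 (M.vol d) :=
    hu.2.mono hTm (Eventually.of_forall fun x => hT.norm_le _)
  have hθtop : MemLp (fun x => T (u x)) ⊤ (M.vol d) :=
    memLp_top_of_bound hTm K (Eventually.of_forall fun x => hK _)
  have hθM : M.IsFunction (fun x => T (u x)) := hu.1.comp T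
  have hθb : MemLp (fun x => T (u x) • b x) 2 (M.vol d) :=
    (h.memLp_smul hu.2 hDu.2 hbm hb).mono (hTm.smul hbm) (Eventually.of_forall fun x => by
      rw [norm_smul, norm_smul]
      exact mul_le_mul_of_nonneg_right (hT.norm_le _) (norm_nonneg _))
  have hDθ : MemLp (fun x => deriv T (u x) • Du x) 2 (M.vol d) :=
    hDu.2.mono ((hT.continuous_deriv.comp_aestronglyMeasurable hu.2.1).smul hDu.2.1)
      (Eventually.of_forall fun x => by
        rw [norm_smul]
        exact mul_le_of_le_one_left (norm_nonneg _) (hT.norm_deriv_le _))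
  have l1 := hone (fun x => u x * T (u x)) ⟨hu.1.comp₂ hθM _,
    memLp_one_iff_integrable.2 (hu.2.integrable_mul hθ)⟩
  have l2 := hone (fun x => inner ℝ (Du x) (T (u x) • b x))
    ⟨hDu.1.comp₂ (hθM.comp₂ hbM fun a c => a • c) _, memLp_inner 1 hDu.2 hθb⟩
  have l3 := hone (fun x => inner ℝ (F₂ x) (deriv T (u x) • Du x))
    ⟨hF₂.1.comp₂ ((hu.1.comp (deriv T)).comp₂ hDu.1 fun a c => a • c) _,
      memLp_inner 1 hF₂.2 hDθ⟩
  have l4 := hweak (fun x => T (u x) • F₂ x)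
    ⟨hθM.comp₂ hF₂.1 fun a c => a • c, hF₂.2.smul hθtop⟩
  -- Antisymmetry moves `A` from `Du` to `Dg n`, whence the sign; boundedness of `T` makes `T(u) Du`
  -- an admissible `L²` function.
  have l5 := (hAweak (fun x => T (u x) • Du x)
    ⟨hθM.comp₂ hDu.1 fun a c => a • c, hDu.2.smul hθtop⟩).neg
  rw [neg_zero] at l5
  have L := ((((l1.const_mul lam).sub (l2.const_mul c₁)).add l3).add l4).add l5
  rw [add_zero, add_zero] at L
  refine tendsto_nhds_unique (L.congr fun n => ?_) tendsto_const_nhds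
  have hgF₃ : MemLp (fun x => g n x • matVec (A x) (Du x)) 2 (M.vol d) := by
    simp only [← matVec_smul]
    exact memLp_matVec (p := ⊤) (q := 2) (fun i j => (hgA n i j).2) hDu.2
  have hE := integral_truncation_eq_zero hs_top hu hDu h hbM hbm hb hF₂ hF₃
    (hanti.mono fun x hx => inner_matVec_self hx _) heq (hg1 n) (hDg n) (hDg' n) (hw n) hgF₃ hT
  rw [← hE]
  congr 1
  · congr 2
    ext1 x
    rw [inner_smul_right, real_inner_comm]
  · rw [← integral_neg]
    refine integral_congr_ae ?_
    filter_upwards [hanti] with x hx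
    rw [inner_smul_right, inner_matVec_of_transpose_eq_neg hx (Du x)]
    ring

/-- The energy inequality. -/
lemma energy_inequality {u : Space d → ℝ} {Du b : Space d → Space d} {lam c₁ c₂ : ℝ}
    {μ : Measure (Space d)} (hu : MemLp u 2 μ) (hDu : MemLp Du 2 μ)
    (hbm : AEStronglyMeasurable b μ)
    (hub : MemLp (fun x => u x • b x) 2 μ) (hc : |c₁| + |c₂| ≤ 1)
    (hen : ∀ T, IsTruncation T → lam * ∫ x, u x * T (u x) ∂μ
      - c₁ * ∫ x, inner ℝ (Du x) (T (u x) • b x) ∂μ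
      + ∫ x, inner ℝ (Du x + c₂ • u x • b x) (deriv T (u x) • Du x) ∂μ = 0) :
    lam * ∫ x, ‖u x‖ ^ 2 ∂μ + ∫ x, ‖Du x‖ ^ 2 ∂μ ≤
      2⁻¹ * ∫ x, ‖Du x‖ ^ 2 ∂μ + 2⁻¹ * ∫ x, ‖u x • b x‖ ^ 2 ∂μ := by
  have iu : Integrable (fun x => ‖u x‖ ^ 2) μ := hu.integrable_norm_pow (by norm_num)
  have iD : Integrable (fun x => ‖Du x‖ ^ 2) μ := hDu.integrable_norm_pow (by norm_num)
  have iub : Integrable (fun x => ‖u x • b x‖ ^ 2) μ := hub.integrable_norm_pow (by norm_num)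
  have hstep : ∀ T, IsTruncation T →
      lam * ∫ x, u x * T (u x) ∂μ + ∫ x, deriv T (u x) * ‖Du x‖ ^ 2 ∂μ ≤
      2⁻¹ * ∫ x, ‖Du x‖ ^ 2 ∂μ + 2⁻¹ * ∫ x, ‖u x • b x‖ ^ 2 ∂μ := by
    intro T hT
    have hTm : AEStronglyMeasurable (fun x => T (u x)) μ :=
      hT.contDiff.continuous.comp_aestronglyMeasurable hu.1
    have hT'm : AEStronglyMeasurable (fun x => deriv T (u x)) μ :=
      hT.continuous_deriv.comp_aestronglyMeasurable hu.1
    have hθb : MemLp (fun x => T (u x) • b x) 2 μ :=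
      hub.mono (hTm.smul hbm) (Eventually.of_forall fun x => by
        rw [norm_smul, norm_smul]
        exact mul_le_mul_of_nonneg_right (hT.norm_le _) (norm_nonneg _))
    have hDθ : MemLp (fun x => deriv T (u x) • Du x) 2 μ :=
      hDu.mono (hT'm.smul hDu.1) (Eventually.of_forall fun x => by
          rw [norm_smul]
          exact mul_le_of_le_one_left (norm_nonneg _) (hT.norm_deriv_le _))
    have j1 := (integrable_inner hDu hθb).const_mul c₁
    have j2 := (integrable_inner hub hDθ).const_mul c₂
    have j3 := integrable_inner hDu hDθ
    have e := hen T hT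
    simp only [inner_add_left] at e
    have e0 : ∀ x, inner ℝ (c₂ • u x • b x) (deriv T (u x) • Du x) =
        c₂ * inner ℝ (u x • b x) (deriv T (u x) • Du x) := fun x => by
      rw [inner_smul_left]; simp
    simp only [e0] at e
    rw [integral_add j3 j2, ← integral_const_mul c₁] at e
    have e1 : ∫ x, inner ℝ (Du x) (deriv T (u x) • Du x) ∂μ =
        ∫ x, deriv T (u x) * ‖Du x‖ ^ 2 ∂μ := by
      simp only [inner_smul_right, real_inner_self_eq_norm_sq]
    rw [e1] at e
    have hle : ∫ x, (c₁ * inner ℝ (Du x) (T (u x) • b x) -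
        c₂ * inner ℝ (u x • b x) (deriv T (u x) • Du x)) ∂μ ≤
        ∫ x, (2⁻¹ * ‖Du x‖ ^ 2 + 2⁻¹ * ‖u x • b x‖ ^ 2) ∂μ := by
      refine integral_mono (j1.sub j2) ((iD.const_mul _).add (iub.const_mul _)) fun x => ?_
      have a1 : |inner ℝ (Du x) (T (u x) • b x)| ≤ ‖Du x‖ * ‖u x • b x‖ := by
        refine (abs_real_inner_le_norm _ _).trans (mul_le_mul_of_nonneg_left ?_ (norm_nonneg _))
        rw [norm_smul, norm_smul]
        exact mul_le_mul_of_nonneg_right (hT.norm_le _) (norm_nonneg _)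
      have a2 : |inner ℝ (u x • b x) (deriv T (u x) • Du x)| ≤ ‖Du x‖ * ‖u x • b x‖ := by
        refine (abs_real_inner_le_norm _ _).trans ?_
        rw [mul_comm]
        refine mul_le_mul_of_nonneg_right ?_ (norm_nonneg _)
        rw [norm_smul]
        exact mul_le_of_le_one_left (norm_nonneg _) (hT.norm_deriv_le _)
      have a3 : c₁ * inner ℝ (Du x) (T (u x) • b x) ≤ |c₁| * (‖Du x‖ * ‖u x • b x‖) := by
        refine (le_abs_self _).trans ?_
        rw [abs_mul]
        exact mul_le_mul_of_nonneg_left a1 (abs_nonneg _)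
      have a4 : -(c₂ * inner ℝ (u x • b x) (deriv T (u x) • Du x)) ≤
          |c₂| * (‖Du x‖ * ‖u x • b x‖) := by
        refine (neg_le_abs _).trans ?_
        rw [abs_mul]
        exact mul_le_mul_of_nonneg_left a2 (abs_nonneg _)
      have a5 : (|c₁| + |c₂|) * (‖Du x‖ * ‖u x • b x‖) ≤ 1 * (‖Du x‖ * ‖u x • b x‖) :=
        mul_le_mul_of_nonneg_right hc (by positivity)
      -- Young's inequality; the total weight `|c₁| + |c₂| ≤ 1` means that the product is spent only
      -- once.
      have a6 := two_mul_le_add_sq ‖Du x‖ ‖u x • b x‖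
      change c₁ * inner ℝ (Du x) (T (u x) • b x) -
        c₂ * inner ℝ (u x • b x) (deriv T (u x) • Du x) ≤ _
      linarith
    rw [integral_sub j1 j2, integral_add (iD.const_mul _) (iub.const_mul _)] at hle
    simp only [integral_const_mul] at hle e
    linarith
  -- The truncations `k sin (s / k)` are not monotone, so `T'` may be negative. Only `|T s| ≤ |s|`,
  -- `|T'| ≤ 1` and the limits `T s → s`, `T' s → 1` are used.
  have t1 : Tendsto (fun n => ∫ x, u x * sinTruncation n (u x) ∂μ) atTop
      (𝓝 (∫ x, ‖u x‖ ^ 2 ∂μ)) := by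
    refine tendsto_integral_of_dominated_convergence (fun x => ‖u x‖ ^ 2)
      (fun n => hu.1.mul ((isTruncation_sinTruncation n).contDiff.continuous.comp_aestronglyMeasurable
        hu.1)) iu (fun n => Eventually.of_forall fun x => ?_) (Eventually.of_forall fun x => ?_)
    · rw [norm_mul, sq]
      exact mul_le_mul_of_nonneg_left ((isTruncation_sinTruncation n).norm_le _) (norm_nonneg _)
    · have := (tendsto_sinTruncation (u x)).const_mul (u x)
      rwa [← sq, ← sq_abs] at this
  have t2 : Tendsto (fun n => ∫ x, deriv (sinTruncation n) (u x) * ‖Du x‖ ^ 2 ∂μ) atTop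
      (𝓝 (∫ x, ‖Du x‖ ^ 2 ∂μ)) := by
    refine tendsto_integral_of_dominated_convergence (fun x => ‖Du x‖ ^ 2)
      (fun n => ((isTruncation_sinTruncation n).continuous_deriv.comp_aestronglyMeasurable
        hu.1).mul (hDu.1.norm.pow 2)) iD (fun n => Eventually.of_forall fun x => ?_)
      (Eventually.of_forall fun x => ?_)
    · rw [norm_mul, norm_pow, norm_norm]
      exact mul_le_of_le_one_left (by positivity) ((isTruncation_sinTruncation n).norm_deriv_le _)
    · simpa using (tendsto_deriv_sinTruncation (u x)).mul_const (‖Du x‖ ^ 2)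
  exact le_of_tendsto ((t1.const_mul lam).add t2)
    (Eventually.of_forall fun n => hstep _ (isTruncation_sinTruncation n))

end FlatDomain

/-! ### Uniqueness for form bounded drifts -/

namespace FlatDomain
open scoped Pointwise
variable {d : ℕ} {M : FlatDomain}

/-- The coefficients of `b · ∇u` tested against `φ`, and of `u b` tested against `∇φ`. -/
def DriftForm.coeff : DriftForm → ℝ × ℝ
  | transport => (1, 0)
  | divergence => (0, 1)

lemma DriftForm.abs_coeff_add_abs_coeff_le (form : DriftForm) :
    |form.coeff.1| + |form.coeff.2| ≤ 1 := by
  cases form <;> simp [coeff]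

lemma driftPairing_eq (form : DriftForm) (b : Space d → Space d) (u : Space d → ℝ)
    (Du : Space d → Space d) (φ : Space d → ℝ) :
    M.driftPairing form b u Du φ = form.coeff.1 * ∫ x, inner ℝ (Du x) (φ x • b x) ∂M.vol d
      - form.coeff.2 * ∫ x, inner ℝ (u x • b x) (gradient φ x) ∂M.vol d := by
  cases form
  · simp only [driftPairing, DriftForm.coeff, one_mul, zero_mul, sub_zero]
    congr 1; ext1 x
    rw [inner_smul_right, real_inner_comm, mul_comm]
  · simp only [driftPairing, DriftForm.coeff, one_mul, zero_mul, zero_sub]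
    congr 2; ext1 x
    rw [inner_smul_left]; simp

/-- A weak solution with a form bounded drift vanishes, once the zeroth order coefficient is
large. -/
lemma IsH1Solution.ae_eq_zero {p : ℝ≥0∞} (hp : 2 ≤ p) {A : Space d → Matrix (Fin d) (Fin d) ℝ}
    (hA : M.MatrixInLp A p) (hanti : ∀ᵐ x ∂M.vol d, (A x).transpose = - A x)
    {g : ℕ → Space d → ℝ} (hg : M.IsCutoffSequence p A g) {b : Space d → Space d}
    (hbM : M.IsFunction b) (hbm : AEStronglyMeasurable b (M.vol d)) {C : NNReal}
    (hC : ∀ v : Space d → ℝ, M.IsTest v → eLpNorm (fun x => v x • b x) 2 (M.vol d) ^ 2 ≤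
      eLpNorm (gradient v) 2 (M.vol d) ^ 2 + C * eLpNorm v 2 (M.vol d) ^ 2)
    {form : DriftForm} {lam : ℝ} (hlam : (C : ℝ) / 2 < lam) {u : Space d → ℝ}
    (hsol : M.IsH1Solution A form b lam u) : u =ᵐ[M.vol d] 0 := by
  obtain ⟨hu, Du, hw, hDu, heq⟩ := hsol
  obtain ⟨φ, h1, h2, h3, h4⟩ := exists_seq_isTest hu hDu hw
  have h : M.IsApprox φ u Du := ⟨h1, h2, h3, h4⟩
  have hb : M.IsFormBounded b := ⟨C, hC⟩
  have hub := h.memLp_smul hu.2 hDu.2 hbm hb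
  have hcub : MemLp (fun x => form.coeff.2 • u x • b x) 2 (M.vol d) := hub.const_smul form.coeff.2
  -- The divergence drift joins the flux: in the equation `-∇ · (b u)` is tested as `+∫ u b · ∇ψ`.
  have hF₂ : M.InLp (fun x => Du x + form.coeff.2 • u x • b x) 2 :=
    ⟨hDu.1.comp₂ (hu.1.comp₂ hbM fun a c => form.coeff.2 • a • c) fun a c => a + c,
      hDu.2.add hcub⟩
  have heq' : ∀ ψ, M.IsTest ψ →
      ∫ x, (lam * u x - form.coeff.1 * inner ℝ (Du x) (b x)) * ψ x ∂M.vol d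
      + ∫ x, inner ℝ (Du x + form.coeff.2 • u x • b x) (gradient ψ x) ∂M.vol d
      + ∫ x, inner ℝ (matVec (A x) (Du x)) (gradient ψ x) ∂M.vol d = 0 := by
    intro ψ hψ
    have e := heq ψ hψ
    rw [driftPairing_eq] at e
    have i1 : Integrable (fun x => u x * ψ x) (M.vol d) := hu.2.integrable_mul (hψ.inLp 2).2
    have i2 := integrable_inner hDu.2 (hb.memLp_test hbm hψ)
    have i3 := integrable_inner hDu.2 (hψ.inLp_gradient 2).2
    have i4 := integrable_inner hcub (hψ.inLp_gradient 2).2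
    have e1 : ∫ x, (lam * u x - form.coeff.1 * inner ℝ (Du x) (b x)) * ψ x ∂M.vol d =
        lam * ∫ x, u x * ψ x ∂M.vol d
        - form.coeff.1 * ∫ x, inner ℝ (Du x) (ψ x • b x) ∂M.vol d := by
      rw [← integral_const_mul, ← integral_const_mul,
        ← integral_sub (i1.const_mul _) (i2.const_mul _)]
      congr 1; ext1 x
      rw [inner_smul_right]; ring
    have e2 : ∫ x, inner ℝ (form.coeff.2 • u x • b x) (gradient ψ x) ∂M.vol d =
        form.coeff.2 * ∫ x, inner ℝ (u x • b x) (gradient ψ x) ∂M.vol d := by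
      rw [← integral_const_mul]
      congr 1; ext1 x
      rw [inner_smul_left]; simp
    simp only [inner_add_left]
    rw [e1, integral_add i3 i4, e2]
    linarith
  have hE := energy_inequality hu.2 hDu.2 hbm hub form.abs_coeff_add_abs_coeff_le
    fun T hT => energy_identity hp hA hanti hg hu hDu h hbM hbm hb hF₂ heq' hT
  have hle : ∫ x, ‖u x • b x‖ ^ 2 ∂M.vol d ≤
      ∫ x, ‖Du x‖ ^ 2 ∂M.vol d + C * ∫ x, ‖u x‖ ^ 2 ∂M.vol d := by
    have hDfin : eLpNorm Du 2 (M.vol d) ^ 2 ≠ ⊤ := ENNReal.pow_ne_top hDu.2.2.ne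
    have hufin : (C : ℝ≥0∞) * eLpNorm u 2 (M.vol d) ^ 2 ≠ ⊤ :=
      ENNReal.mul_ne_top ENNReal.coe_ne_top (ENNReal.pow_ne_top hu.2.2.ne)
    rw [integral_norm_sq_eq_toReal hub, integral_norm_sq_eq_toReal hDu.2,
      integral_norm_sq_eq_toReal hu.2, ← ENNReal.coe_toReal C, ← ENNReal.toReal_mul,
      ← ENNReal.toReal_add hDfin hufin]
    exact ENNReal.toReal_mono (ENNReal.add_ne_top.2 ⟨hDfin, hufin⟩)
      (h.eLpNorm_smul_le hu.2 hDu.2 hbm hC)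
  have hnn : 0 ≤ ∫ x, ‖u x‖ ^ 2 ∂M.vol d := integral_nonneg fun x => by positivity
  have hz : ∫ x, ‖u x‖ ^ 2 ∂M.vol d = 0 := by
    refine le_antisymm ?_ hnn
    by_contra! hpos
    -- By `hE` and `hle` the gradient terms cancel, leaving `(lam - C / 2) ∫ ‖u‖² ≤ 0`.
    nlinarith
  rw [integral_eq_zero_iff_of_nonneg (fun x => by positivity)
    (hu.2.integrable_norm_pow (by norm_num))] at hz
  filter_upwards [hz] with x hx
  simpa using hx

/-- The converse half of the equivalence; the weak gradient is chosen to be identically zero. -/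
lemma isH1Solution_of_ae_eq_zero (A : Space d → Matrix (Fin d) (Fin d) ℝ) (form : DriftForm)
    (b : Space d → Space d) (lam : ℝ) {u : Space d → ℝ} (huM : M.IsFunction u)
    (hu : u =ᵐ[M.vol d] 0) : M.IsH1Solution A form b lam u := by
  have hint : ∀ v : Space d → ℝ, ∫ x, u x * v x ∂M.vol d = 0 := fun v =>
    integral_eq_zero_of_ae (hu.mono fun x hx => by simp [hx])
  have h0 : M.IsFunction (fun _ : Space d => (0 : Space d)) := by
    cases M
    · trivial
    · exact fun _ _ => rfl
  refine ⟨⟨huM, MemLp.zero.ae_eq hu.symm⟩, fun _ => 0, ⟨huM, h0, ?_, ?_, ?_⟩, ⟨h0, MemLp.zero⟩, ?_⟩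
  · exact ((integrable_zero _ _ _).congr hu.symm).locallyIntegrable
  · exact (integrable_zero _ _ _).locallyIntegrable
  · intro φ _ i
    rw [hint]
    simp
  · intro φ _
    have hA0 : ∀ x, matVec (A x) 0 = 0 := fun x => by ext i; simp [matVec]
    cases form <;> simp [driftPairing, hint, hA0]

/-- Drifts in `L^r` with `r > d`, and drifts in `L^d` if `d ≥ 3`, are form bounded. -/
lemma isFormBounded_of_inLp_or (hd : 2 ≤ d) {b : Space d → Space d}
    (hb : (∃ r : ℝ≥0∞, (d : ℝ≥0∞) < r ∧ M.InLp b r) ∨ (3 ≤ d ∧ M.InLp b (d : ℝ≥0∞))) :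
    M.IsFormBounded b := by
  obtain ⟨r, hr, hb⟩ | ⟨h3, hb⟩ := hb
  · induction r with
    | top => exact isFormBounded_of_inLp_top hb
    | coe r => exact isFormBounded_of_inLp hd (Or.inl (by exact_mod_cast hr)) hb
  · exact isFormBounded_of_inLp hd (s := (d : NNReal)) (Or.inr ⟨h3, rfl⟩) (by simpa using hb)

end FlatDomain

theorem mainTheorem8 (d : ℕ) (hd : 2 ≤ d) :
    ∃ K : ℝ, 0 < K ∧
      ∀ (M : FlatDomain) (p : ℝ≥0∞), 2 ≤ p →
      ∀ (A : EuclideanSpace ℝ (Fin d) → Matrix (Fin d) (Fin d) ℝ),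
        M.MatrixInLp A p →
        (∀ᵐ x ∂(M.vol d), (A x).transpose = - A x) →
      ∀ (g : ℕ → EuclideanSpace ℝ (Fin d) → ℝ), M.IsCutoffSequence p A g →
      ∀ (b₂ : EuclideanSpace ℝ (Fin d) → EuclideanSpace ℝ (Fin d)),
        ((∃ r : ℝ≥0∞, (d : ℝ≥0∞) < r ∧ M.InLp b₂ r) ∨
          (3 ≤ d ∧ M.InLp b₂ (d : ℝ≥0∞) ∧
            eLpNorm b₂ (d : ℝ≥0∞) (M.vol d) ≤ ENNReal.ofReal K)) →
      ∀ form : FlatDomain.DriftForm,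
        ∃ lam₀ : ℝ, 0 < lam₀ ∧ ∀ lam : ℝ, lam₀ < lam →
          ∀ u : EuclideanSpace ℝ (Fin d) → ℝ, M.IsFunction u →
            (M.IsH1Solution A form b₂ lam u ↔ u =ᵐ[M.vol d] 0) := by
  -- Any positive constant serves: `λ₀` may depend on `b`, and the splitting height absorbs the size
  -- of `b`.
  refine ⟨1, one_pos, fun M p hp A hA hanti g hg b hb form => ?_⟩
  have hbf : M.IsFunction b ∧ AEStronglyMeasurable b (M.vol d) := by
    obtain ⟨r, -, hb⟩ | ⟨-, hb, -⟩ := hb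
    exacts [⟨hb.1, hb.2.1⟩, ⟨hb.1, hb.2.1⟩]
  obtain ⟨C, hC⟩ := FlatDomain.isFormBounded_of_inLp_or hd
    (hb.imp_right fun h => ⟨h.1, h.2.1⟩)
  -- The threshold is `C / 2`; adding `1` makes it positive even when `C = 0`.
  refine ⟨(C : ℝ) / 2 + 1, by positivity, fun lam hlam u hu => ⟨fun h => ?_, fun h => ?_⟩⟩
  · exact h.ae_eq_zero hp hA hanti hg hbf.1 hbf.2 hC (by linarith)
  · exact FlatDomain.isH1Solution_of_ae_eq_zero A form b lam hu h
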